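/- Let $d\ge 1$. A similitude of $\mathbb R^d$ is a map $x\mapsto \rho Px+a$ with $\rho>0$, $P$ a $d\times d$ orthogonal matrix and $a\in\mathbb R^d$; it is contractive, with contraction ratio $\rho$, if $\rho<1$. The self-similar set generated by a finite family (IFS) $\{f_i\}$ of contractive similitudes of $\mathbb R^d$ is the unique non-empty compact set $K$ with $K=\bigcup_i f_i(K)$; it is nontrivial if it is not a singleton. Let $E,F\subset\mathbb R^d$ be two totally disconnected nontrivial self-similar sets, generated by the IFSs $\Phi=\{\phi_i\}_{i=1}^{\ell}$ and $\Psi=\{\psi_j\}_{j=1}^{m}$ of contractive similitudes with contraction ratios $\rho_1,\dots,\rho_\ell$ and $\gamma_1,\dots,\gamma_m$ respectively (so $\ell,m\ge 2$). Suppose that $F$ can be affinely embedded into $E$, i.e. there are an invertible real $d\times d$ matrix $M$ and $a\in\mathbb R^d$ with $M(F)+a\subset E$. Assume moreover that $\Phi$ satisfies the strong separation condition, i.e. the sets $\phi_i(E)$, $1\le i\le\ell$, are pairwise disjoint, and that the Hausdorff dimension of $E$ satisfies $\dim_H E<c$, where $$c=\begin{cases}1/4,&\text{if }\ell=2,\\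 1/4,&\text{if }\ell\ge 3,\ \lambda=1,\\ 1/(2\lambda+2),&\text{if }\ell\ge 3,\ \lambda>1,\end{cases}$$ and $\lambda$ is the dimension of the $\mathbb Q$-linear span of $\log\rho_1,\dots,\log\rho_\ell$ in $\mathbb R$. Then for each $1\le j\le m$ there exist non-negative rational numbers $t_{1,j},\dots,t_{\ell,j}$ such that $$\gamma_j=\prod_{i=1}^{\ell}\rho_i^{t_{i,j}}.$$ In particular, if $\rho_i=\rho$ for all $1\le i\le\ell$, then $\log\gamma_j/\log\rho\in\mathbb Q$ for all $1\le j\le m$. -/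

import Mathlib

namespace AffineEmbedding

/-- `ℝ^d` with the Euclidean norm. -/
abbrev Rd (d : ℕ) : Type := EuclideanSpace ℝ (Fin d)

/-- `f` is a contractive similitude of `ℝ^d` with contraction ratio `ρ`, that is,
`f x = ρ P x + a` with `0 < ρ < 1`, `P` an orthogonal transformation and `a` a vector. -/
def IsContractingSimilitude {d : ℕ} (f : Rd d → Rd d) (ρ : ℝ) : Prop :=
  0 < ρ ∧ ρ < 1 ∧ ∃ (P : Rd d ≃ₗᵢ[ℝ] Rd d) (a : Rd d), ∀ x, f x = ρ • P x + a

/-- `K` is the attractor of the finite family of maps `φ`: the non-empty compact set with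
`K = ⋃ i, φ i (K)`. (It is unique when the maps are contractive.) -/
def IsAttractor {d ℓ : ℕ} (φ : Fin ℓ → Rd d → Rd d) (K : Set (Rd d)) : Prop :=
  K.Nonempty ∧ IsCompact K ∧ K = ⋃ i, φ i '' K

/-- `K` is the self-similar set generated by the IFS `φ` of contractive similitudes, whose
contraction ratios are `ρ`. -/
def IsSelfSimilarSet {d ℓ : ℕ} (φ : Fin ℓ → Rd d → Rd d) (ρ : Fin ℓ → ℝ)
    (K : Set (Rd d)) : Prop :=
  (∀ i, IsContractingSimilitude (φ i) (ρ i)) ∧ IsAttractor φ K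

/-- The strong separation condition for an IFS `φ` with attractor `K`: the sets `φ i (K)` are
pairwise disjoint. -/
def StrongSeparation {d ℓ : ℕ} (φ : Fin ℓ → Rd d → Rd d) (K : Set (Rd d)) : Prop :=
  ∀ i j : Fin ℓ, i ≠ j → Disjoint (φ i '' K) (φ j '' K)

/-- `A` can be affinely embedded into `B`: `f(A) ⊆ B` for some `f x = M x + a` with `M` an
invertible linear map of `ℝ^d`. -/
def AffinelyEmbeds {d : ℕ} (A B : Set (Rd d)) : Prop :=
  ∃ (M : Rd d ≃ₗ[ℝ] Rd d) (a : Rd d), (fun x => M x + a) '' A ⊆ B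

/-- The dimension over `ℚ` of the linear span of `log ρ_1, …, log ρ_ℓ`. -/
noncomputable def logRank {ℓ : ℕ} (ρ : Fin ℓ → ℝ) : ℕ :=
  Module.finrank ℚ (Submodule.span ℚ (Set.range fun i => Real.log (ρ i)))

/-- The dimension threshold `c`, for an IFS of `ℓ ≥ 2` maps and `lam = dim span ≥ 1`. -/
noncomputable def threshold (ℓ lam : ℕ) : ℝ :=
  if ℓ = 2 then 1 / 4
  else if lam = 1 then 1 / 4
  else 1 / (2 * (lam : ℝ) + 2)

end AffineEmbedding

/-!
Write `φ_i = ρ_i P_i + a_i` for the maps of `E` and fix one map `ψ = γ P + b` of `F`. If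
`x ↦ M x + a` sends `F` into `E`, the sets `M ψ^[m] F + a` shrink to a point of `E`. Let `w` be a
coding of this point, and blow up along the cylinder of `E` coded by its first `k` letters. By
strong separation, the distance of two fixed points of `F` becomes the distance
`γ ^ m / (ρ (w 0) ⋯ ρ (w (k - 1))) * ‖M P ^ m v‖` between two points of `E`, as soon as the first
factor is at most `1` (`exists_renormalized_distances`). For every `t > dim_H E` the set `E` is
covered by `O(δ ^ (-t))` sets of diameter `δ`: a Hausdorff cover with `∑ r ^ t ≤ 1` can be made of
cylinders, and then it can be iterated (`hasBoxBound_of_dimH_lt`). So the set of distances of `E`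
has covering exponent `2 t`.

The rotation `P` is eliminated first. The ratios of `‖M P ^ (m + r) v‖` to `‖M P ^ m v‖` are
quotients of distances, hence lie in a set of covering exponent `4 t < 1`, in which chains of small
steps stay near their starting point (`HasBoxBound.chain_le`). As `P` is recurrent, this forces
`m ↦ ‖M P ^ m v‖` to be almost invariant under all multiples of some shift. The shift acts on a
finite-dimensional space of sequences, where an operator all of whose powers are close to the
identity is the identity; so the sequence is periodic (`exists_period`).

Along the multiples of the period `p`, logarithms turn the distances into an orbit on the circle
under the rotations by `α_i = log ρ_i / log (γ ^ p)`, applied in the order given by `w`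
(`hasBoxBound_orbit`). It has covering exponent `2 t`, and it remains to see that a nonnegative
integer combination of the `α_i`, not all of whose coefficients vanish, is rational.

* For `lam` rationally independent logarithms and `2 t < 1 / (lam + 1)`, approximate the `α_i`
  simultaneously by rationals `P_i / q`. If the accumulated error along `w` reached `1 / (4 q)`, the
  orbit would have too many separated points. So it stays bounded for a sequence of
  approximations tending to `α`; two prefixes of `w` then have equal sums with respect to the whole
  rational affine space that these approximations span, and the difference of the two prefixes is
  the required combination (`exists_relation_of_rotations`).
* For two maps and `2 t < 1 / 2`, the differences of the orbit contain `n α_1 + a (α_0 - α_1)`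
  modulo `1` for all integer points `(n, a)` of a strip. Small integer vectors then have
  a far smaller component along the circle than across the strip, whereas adding multiples of a
  very small vector to a fixed one produces a vector for which this fails
  (`exists_relation_of_two_rotations`).
-/

namespace AffineEmbedding

open MeasureTheory Metric
open scoped ENNReal NNReal BoundedContinuousFunction RealInnerProductSpace

/-! ### Polynomial covering bounds -/

/-- `A` can be covered by `O(δ ^ (-s))` sets of diameter at most `δ`, for all `0 < δ ≤ 1`. The
cover is encoded by a labelling `c` of the points with natural numbers below `N`. -/
def HasBoxBound {X : Type*} [PseudoMetricSpace X] (A : Set X) (s : ℝ) : Prop :=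
  ∃ C : ℝ, 0 < C ∧ ∀ δ : ℝ, 0 < δ → δ ≤ 1 → ∃ (N : ℕ) (c : X → ℕ), (N : ℝ) ≤ C * δ ^ (-s) ∧
    (∀ x ∈ A, c x < N) ∧ ∀ x ∈ A, ∀ y ∈ A, c x = c y → dist x y ≤ δ

namespace HasBoxBound

variable {X Y : Type*} [PseudoMetricSpace X] [PseudoMetricSpace Y]

lemma mono {A B : Set X} {s : ℝ} (hA : HasBoxBound A s) (hBA : B ⊆ A) : HasBoxBound B s := by
  obtain ⟨C, hC, h⟩ := hA
  refine ⟨C, hC, fun δ h0 h1 => ?_⟩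
  obtain ⟨N, c, h2, h3, h4⟩ := h δ h0 h1
  exact ⟨N, c, h2, fun x hx => h3 x (hBA hx), fun x hx y hy => h4 x (hBA hx) y (hBA hy)⟩

lemma image {A : Set X} {s : ℝ} (hA : HasBoxBound A s) (f : X → Y) (L : ℝ) (hL : 0 ≤ L)
    (hf : ∀ x ∈ A, ∀ y ∈ A, dist (f x) (f y) ≤ L * dist x y) : HasBoxBound (f '' A) s := by
  obtain ⟨C, hC, h⟩ := hA
  have hL1 : 0 < L + 1 := by linarith
  refine ⟨C * (L + 1) ^ s, by positivity, fun δ h0 h1 => ?_⟩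
  obtain ⟨N, c, h2, h3, h4⟩ := h (δ / (L + 1)) (by positivity)
    ((div_le_one hL1).2 (by linarith))
  have key : ∀ z ∈ f '' A, ∃ x ∈ A, f x = z := fun z hz => hz
  rcases isEmpty_or_nonempty X with hX | hX
  · have hemp : f '' A = ∅ := by simp [Set.eq_empty_of_isEmpty A]
    exact ⟨0, fun _ => 0, by simp only [Nat.cast_zero]; positivity, by simp [hemp], by simp [hemp]⟩
  choose! g hgA hg using key
  refine ⟨N, fun z => c (g z), ?_, fun z hz => h3 _ (hgA z hz), fun z hz w hw hzw => ?_⟩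
  · rw [Real.div_rpow h0.le hL1.le, Real.rpow_neg hL1.le, div_inv_eq_mul] at h2
    linarith
  · have h5 := h4 _ (hgA z hz) _ (hgA w hw) hzw
    have h6 := hf _ (hgA z hz) _ (hgA w hw)
    rw [hg z hz, hg w hw] at h6
    rw [le_div_iff₀ hL1] at h5
    nlinarith [dist_nonneg (x := g z) (y := g w)]

lemma prod {A : Set X} {B : Set Y} {s t : ℝ} (hA : HasBoxBound A s) (hB : HasBoxBound B t) :
    HasBoxBound (A ×ˢ B) (s + t) := by
  obtain ⟨C, hC, h⟩ := hA
  obtain ⟨D, hD, k⟩ := hB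
  refine ⟨C * D, by positivity, fun δ h0 h1 => ?_⟩
  obtain ⟨N, c, h2, h3, h4⟩ := h δ h0 h1
  obtain ⟨M, d, k2, k3, k4⟩ := k δ h0 h1
  refine ⟨N * M, fun p => c p.1 * M + d p.2, ?_, ?_, ?_⟩
  · push_cast
    calc (N : ℝ) * M ≤ (C * δ ^ (-s)) * (D * δ ^ (-t)) := by gcongr
      _ = C * D * δ ^ (-(s + t)) := by rw [neg_add, Real.rpow_add h0]; ring
  · rintro ⟨x, y⟩ ⟨hx, hy⟩
    have hx' := h3 x hx
    have hy' := k3 y hy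
    simp only
    calc c x * M + d y < c x * M + M := by omega
      _ = (c x + 1) * M := by ring
      _ ≤ N * M := Nat.mul_le_mul_right _ hx'
  · rintro ⟨x, y⟩ ⟨hx, hy⟩ ⟨x', y'⟩ ⟨hx', hy'⟩ heq
    simp only at hx hy hx' hy' heq
    have hM := k3 y hy
    have hM' := k3 y' hy'
    have e1 : c x = c x' := by
      have := congrArg (· / M) heq
      simpa [Nat.mul_add_div (by omega : 0 < M), Nat.add_div, mul_comm, Nat.div_eq_of_lt hM,
        Nat.div_eq_of_lt hM', Nat.mul_div_cancel_left _ (by omega : 0 < M), Nat.mod_eq_of_lt hM,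
        Nat.mod_eq_of_lt hM', hM, hM', (by omega : 0 < M)] using this
    have e2 : d y = d y' := by rw [e1] at heq; omega
    exact max_le (h4 x hx x' hx' e1) (k4 y hy y' hy' e2)

/-- Separated points are counted by a covering bound. -/
lemma card_le {A : Set X} {s : ℝ} (hA : HasBoxBound A s) :
    ∃ C : ℝ, 0 < C ∧ ∀ δ : ℝ, 0 < δ → δ ≤ 1 → ∀ (n : ℕ) (x : ℕ → X), (∀ i < n, x i ∈ A) →
      (∀ i < n, ∀ j < n, i < j → δ < dist (x i) (x j)) → (n : ℝ) ≤ C * δ ^ (-s) := by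
  obtain ⟨C, hC, h⟩ := hA
  refine ⟨C, hC, fun δ h0 h1 n x hx hsep => ?_⟩
  obtain ⟨N, c, h2, h3, h4⟩ := h δ h0 h1
  refine le_trans ?_ h2
  have hinj : Set.InjOn (fun i => c (x i)) (Finset.range n) := by
    have aux : ∀ i < n, ∀ j < n, i < j → c (x i) ≠ c (x j) := fun i hi j hj hij he =>
      absurd (h4 _ (hx i hi) _ (hx j hj) he) (not_le.2 (hsep i hi j hj hij))
    intro i hi j hj hij
    simp only [Finset.coe_range, Set.mem_Iio] at hi hj
    rcases lt_trichotomy i j with hlt | heq | hgt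
    · exact absurd hij (aux i hi j hj hlt)
    · exact heq
    · exact absurd hij.symm (aux j hj i hi hgt)
  have := Finset.card_le_card_of_injOn (s := Finset.range n) (t := Finset.range N)
    (fun i => c (x i)) (fun i hi => by simpa using h3 _ (hx i (by simpa using hi))) hinj
  simpa using this

end HasBoxBound

/-- A real sequence that starts at `0` and rises by at most `η` per step meets each of the
intervals `[3ηi, 3ηi + η]` below a level that it reaches. -/
lemma exists_index_near_of_small_steps {u : ℕ → ℝ} {η : ℝ} (h0 : u 0 = 0) (hη : 0 < η)
    (hstep : ∀ k, u (k + 1) ≤ u k + η) {K J : ℕ} (hK : 3 * η * J ≤ u K) (i : ℕ) (hi : i ≤ J) :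
    ∃ k ≤ K, 3 * η * i ≤ u k ∧ u k ≤ 3 * η * i + η := by
  classical
  have hex : ∃ k, 3 * η * i ≤ u k := ⟨K, le_trans (by gcongr) hK⟩
  refine ⟨Nat.find hex, Nat.find_min' hex (le_trans (by gcongr) hK), Nat.find_spec hex, ?_⟩
  rcases hk : Nat.find hex with _ | k
  · rw [h0]; positivity
  · have := Nat.find_min hex (m := k) (by omega)
    push Not at this
    linarith [hstep k]

/-- A power of a small number is arbitrarily large when the exponent is negative. -/
lemma exists_small_rpow {e A : ℝ} (he : 0 < e) (hA : 0 < A) :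
    ∃ η : ℝ, 0 < η ∧ η ≤ 1 ∧ ∀ x, 0 < x → x ≤ η → x ^ e < A := by
  refine ⟨min 1 ((A / 2) ^ (1 / e)), by positivity, min_le_left _ _, fun x hx hxe => ?_⟩
  calc x ^ e ≤ ((A / 2) ^ (1 / e)) ^ e :=
        Real.rpow_le_rpow hx.le (hxe.trans (min_le_right _ _)) he.le
    _ = A / 2 := by rw [← Real.rpow_mul (by positivity), one_div_mul_cancel he.ne', Real.rpow_one]
    _ < A := by linarith

/-- In a subset of `ℝ` of covering exponent less than one, chains with small steps stay near
their starting point. -/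
lemma HasBoxBound.chain_le {X : Set ℝ} {s : ℝ} (hX : HasBoxBound X s) (hs : s < 1) {ε : ℝ}
    (hε : 0 < ε) : ∃ η : ℝ, 0 < η ∧ ∀ x : ℕ → ℝ, (∀ j, x j ∈ X) →
      (∀ j, |x (j + 1) - x j| ≤ η) → ∀ j, |x j - x 0| ≤ ε := by
  obtain ⟨C, hC, h⟩ := hX.card_le
  obtain ⟨η, hη, hη1, hsmall⟩ := exists_small_rpow (e := 1 - s) (A := ε / (3 * C)) (by linarith)
    (by positivity)
  refine ⟨η, hη, fun x hx hstep j => ?_⟩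
  by_contra! hj
  obtain ⟨σ, hσ, hσj⟩ : ∃ σ : ℝ, |σ| = 1 ∧ ε < σ * (x j - x 0) := by
    rcases le_total 0 (x j - x 0) with h0 | h0
    · exact ⟨1, by simp, by rwa [one_mul, ← abs_of_nonneg h0]⟩
    · exact ⟨-1, by simp, by rwa [neg_one_mul, ← abs_of_nonpos h0]⟩
  set J := ⌊ε / (3 * η)⌋₊ with hJ
  have hJ1 : 3 * η * J ≤ ε := by
    have := Nat.floor_le (a := ε / (3 * η)) (by positivity)
    rw [← hJ, le_div_iff₀ (by positivity)] at this
    linarith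
  have hpick := exists_index_near_of_small_steps (u := fun k => σ * (x k - x 0)) (η := η)
    (by simp) hη (fun k => by
      have h1 : |σ * (x (k + 1) - x k)| ≤ η := by rw [abs_mul, hσ, one_mul]; exact hstep k
      have := (abs_le.1 h1).2
      linarith) (K := j) (J := J) (hJ1.trans hσj.le)
  choose! k hk1 hk2 hk3 using hpick
  have hcard := h η hη hη1 (J + 1) (fun i => x (k i)) (fun i _ => hx _) (by
    intro i hi i' hi' hii
    have a1 := hk3 i (by omega)
    have a2 := hk2 i' (by omega)
    have hii' : (i : ℝ) + 1 ≤ i' := by exact_mod_cast hii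
    have a3 : η < σ * (x (k i') - x (k i)) := by nlinarith
    rw [dist_comm, Real.dist_eq]
    calc η < |σ * (x (k i') - x (k i))| := a3.trans_le (le_abs_self _)
      _ = _ := by rw [abs_mul, hσ, one_mul])
  have hJ2 : ε / (3 * η) < J + 1 := Nat.lt_floor_add_one _
  push_cast at hcard
  have h2 : ε / (3 * η) < C * η ^ (-s) := hJ2.trans_le hcard
  have h3 := hsmall η hη le_rfl
  rw [Real.rpow_sub hη, Real.rpow_one] at h3
  rw [Real.rpow_neg hη.le] at h2
  have hpos : 0 < η ^ s := by positivity
  rw [div_lt_iff₀ (by positivity)] at h2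
  rw [div_lt_div_iff₀ hpos (by positivity)] at h3
  have : ε * η ^ s < 3 * η * C := by
    calc ε * η ^ s < (C * (η ^ s)⁻¹ * (3 * η)) * η ^ s := by gcongr
      _ = 3 * η * C := by field_simp
  linarith

/-! ### Symbolic coding of an attractor -/

section Coding

variable {X : Type*} {ℓ : ℕ}

/-- The composition `φ (w 0) ∘ ⋯ ∘ φ (w (k - 1))` along the first `k` letters of `w`. -/
def prefixMap (φ : Fin ℓ → X → X) (w : ℕ → Fin ℓ) : ℕ → X → X
  | 0 => id
  | k + 1 => prefixMap φ w k ∘ φ (w k)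

/-- The contraction ratio of `prefixMap φ w k`, when `ρ` lists the ratios of `φ`. -/
def prefixRatio (ρ : Fin ℓ → ℝ) (w : ℕ → Fin ℓ) (k : ℕ) : ℝ := ∏ i ∈ Finset.range k, ρ (w i)

lemma prefixRatio_succ (ρ : Fin ℓ → ℝ) (w : ℕ → Fin ℓ) (k : ℕ) :
    prefixRatio ρ w (k + 1) = prefixRatio ρ w k * ρ (w k) := Finset.prod_range_succ _ _

lemma prefixRatio_zero (ρ : Fin ℓ → ℝ) (w : ℕ → Fin ℓ) : prefixRatio ρ w 0 = 1 :=
  Finset.prod_range_zero _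

lemma prefixRatio_pos {ρ : Fin ℓ → ℝ} (hρ : ∀ i, 0 < ρ i) (w : ℕ → Fin ℓ) (k : ℕ) :
    0 < prefixRatio ρ w k := Finset.prod_pos fun _ _ => hρ _

lemma prefixRatio_succ_le {ρ : Fin ℓ → ℝ} (hρ : ∀ i, 0 < ρ i) (hρ1 : ∀ i, ρ i < 1)
    (w : ℕ → Fin ℓ) (k : ℕ) : prefixRatio ρ w (k + 1) ≤ prefixRatio ρ w k := by
  rw [prefixRatio_succ]
  exact mul_le_of_le_one_right (prefixRatio_pos hρ w k).le (hρ1 _).le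

lemma exists_lower_bound {n : ℕ} {ρ : Fin n → ℝ} (hρ : ∀ i, 0 < ρ i) :
    ∃ r : ℝ, 0 < r ∧ r ≤ 1 ∧ ∀ i, r ≤ ρ i := by
  rcases isEmpty_or_nonempty (Fin n) with h | h
  · exact ⟨1, one_pos, le_rfl, fun i => h.elim i⟩
  · obtain ⟨i, hi⟩ := Finite.exists_min ρ
    exact ⟨min 1 (ρ i), lt_min one_pos (hρ i), min_le_left _ _,
      fun j => (min_le_right _ _).trans (hi j)⟩

lemma exists_upper_bound_lt_one {n : ℕ} {ρ : Fin n → ℝ} (hρ : ∀ i, ρ i < 1) :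
    ∃ r : ℝ, 0 < r ∧ r < 1 ∧ ∀ i, ρ i ≤ r := by
  rcases isEmpty_or_nonempty (Fin n) with h | h
  · exact ⟨1 / 2, by norm_num, by norm_num, fun i => h.elim i⟩
  · obtain ⟨i, hi⟩ := Finite.exists_max ρ
    exact ⟨max (1 / 2) (ρ i), by positivity, max_lt (by norm_num) (hρ i),
      fun j => (hi j).trans (le_max_right _ _)⟩

lemma exists_prefixRatio_lt {ρ : Fin ℓ → ℝ} (hρ : ∀ i, 0 < ρ i) (hρ1 : ∀ i, ρ i < 1)
    (w : ℕ → Fin ℓ) {e : ℝ} (he : 0 < e) : ∃ k, prefixRatio ρ w k < e := by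
  obtain ⟨r, hr0, hr1, hr⟩ := exists_upper_bound_lt_one hρ1
  obtain ⟨k, hk⟩ := exists_pow_lt_of_lt_one he hr1
  refine ⟨k, lt_of_le_of_lt ?_ hk⟩
  calc prefixRatio ρ w k ≤ ∏ _i ∈ Finset.range k, r :=
        Finset.prod_le_prod (fun _ _ => (hρ _).le) fun _ _ => hr _
    _ = r ^ k := by simp

lemma exists_coding {φ : Fin ℓ → X → X} {E : Set X} (hE : E ⊆ ⋃ i, φ i '' E) {x : X}
    (hx : x ∈ E) : ∃ (w : ℕ → Fin ℓ) (y : ℕ → X), (∀ k, y k ∈ E) ∧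
      (∀ k, prefixMap φ w k (y k) = x) ∧ ∀ k, y k = φ (w k) (y (k + 1)) := by
  have step : ∀ z : E, ∃ (i : Fin ℓ) (z' : E), (z : X) = φ i z' := fun z => by
    obtain ⟨i, z', hz', h⟩ := Set.mem_iUnion.1 (hE z.2)
    exact ⟨i, ⟨z', hz'⟩, h.symm⟩
  choose idx nxt hstep using step
  let y : ℕ → E := fun k => nxt^[k] ⟨x, hx⟩
  have hy : ∀ k, (y k : X) = φ (idx (y k)) (y (k + 1)) := fun k => by
    simp only [y, Function.iterate_succ_apply']
    exact hstep _
  refine ⟨fun k => idx (y k), fun k => y k, fun k => (y k).2, fun k => ?_, hy⟩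
  induction k with
  | zero => rfl
  | succ k ih =>
    simp only at ih
    rw [hy k] at ih
    exact ih

end Coding

section MetricCoding

variable {X : Type*} [MetricSpace X] {ℓ : ℕ} {φ : Fin ℓ → X → X} {ρ : Fin ℓ → ℝ} {E : Set X}

lemma dist_prefixMap (hφ : ∀ i x y, dist (φ i x) (φ i y) = ρ i * dist x y) (w : ℕ → Fin ℓ)
    (k : ℕ) (x y : X) :
    dist (prefixMap φ w k x) (prefixMap φ w k y) = prefixRatio ρ w k * dist x y := by
  induction k generalizing x y with
  | zero => simp [prefixMap, prefixRatio]
  | succ k ih =>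
    rw [prefixRatio_succ, mul_assoc, ← hφ, ← ih]
    rfl

lemma exists_gap (hφ : ∀ i, Continuous (φ i)) (hE : IsCompact E)
    (hdisj : ∀ i j, i ≠ j → Disjoint (φ i '' E) (φ j '' E)) :
    ∃ D : ℝ, 0 < D ∧ ∀ i j, i ≠ j → ∀ x ∈ φ i '' E, ∀ y ∈ φ j '' E, D ≤ dist x y := by
  have h : ∀ p : Fin ℓ × Fin ℓ, ∃ D : ℝ, 0 < D ∧
      (p.1 ≠ p.2 → ∀ x ∈ φ p.1 '' E, ∀ y ∈ φ p.2 '' E, D ≤ dist x y) := fun p => by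
    by_cases hp : p.1 = p.2
    · exact ⟨1, one_pos, fun h => absurd hp h⟩
    · obtain ⟨r, hr, hr'⟩ := Metric.exists_pos_forall_lt_edist (hE.image (hφ p.1))
        (hE.image (hφ p.2)).isClosed (hdisj _ _ hp)
      refine ⟨r, hr, fun _ x hx y hy => ?_⟩
      have := hr' x hx y hy
      rw [edist_nndist, ENNReal.coe_lt_coe] at this
      exact_mod_cast this.le
  choose D hD0 hD using h
  rcases isEmpty_or_nonempty (Fin ℓ × Fin ℓ) with he | he
  · exact ⟨1, one_pos, fun i j => (he.elim (i, j))⟩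
  · obtain ⟨p, hp⟩ := Finite.exists_min D
    exact ⟨D p, hD0 p, fun i j hij x hx y hy => (hp (i, j)).trans (hD (i, j) hij x hx y hy)⟩

/-- Points of the attractor that are close to a point coded by `w` lie in the same cylinder. -/
lemma mem_prefixMap_image (hφ : ∀ i x y, dist (φ i x) (φ i y) = ρ i * dist x y)
    (hρ : ∀ i, 0 < ρ i) (hρ1 : ∀ i, ρ i < 1) (hE : E ⊆ ⋃ i, φ i '' E) {D : ℝ} (hD : 0 < D)
    (hgap : ∀ i j, i ≠ j → ∀ x ∈ φ i '' E, ∀ y ∈ φ j '' E, D ≤ dist x y)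
    {w : ℕ → Fin ℓ} {y : ℕ → X} {e : X} (hy : ∀ k, y k ∈ E)
    (hye : ∀ k, prefixMap φ w k (y k) = e) (hyw : ∀ k, y k = φ (w k) (y (k + 1)))
    {x : X} (hx : x ∈ E) (k : ℕ) (hd : dist x e < D * prefixRatio ρ w k) :
    x ∈ prefixMap φ w (k + 1) '' E := by
  have key : ∀ k, x ∈ prefixMap φ w k '' E → dist x e < D * prefixRatio ρ w k →
      x ∈ prefixMap φ w (k + 1) '' E := by
    rintro k ⟨x', hx', rfl⟩ hd
    rw [← hye k, dist_prefixMap hφ, mul_comm D,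
      mul_lt_mul_iff_right₀ (prefixRatio_pos hρ w k)] at hd
    obtain ⟨i, x'', hx'', rfl⟩ := Set.mem_iUnion.1 (hE hx')
    have hi : i = w k := by
      by_contra hne
      exact absurd hd (not_lt.2 (hgap i (w k) hne _ ⟨x'', hx'', rfl⟩ _
        ⟨y (k + 1), hy _, (hyw k).symm⟩))
    exact ⟨x'', hx'', by rw [hi]; rfl⟩
  induction k with
  | zero => exact key 0 ⟨x, hx, rfl⟩ hd
  | succ k ih =>
    exact key (k + 1) (ih (hd.trans_le
      (mul_le_mul_of_nonneg_left (prefixRatio_succ_le hρ hρ1 w k) hD.le))) hd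

/-- A small ball meets the attractor inside a single cylinder of comparable size. -/
lemma exists_cylinder_of_ball (hφ : ∀ i x y, dist (φ i x) (φ i y) = ρ i * dist x y)
    (hρ : ∀ i, 0 < ρ i) (hρ1 : ∀ i, ρ i < 1) (hE : E ⊆ ⋃ i, φ i '' E) {D : ℝ} (hD : 0 < D)
    (hgap : ∀ i j, i ≠ j → ∀ x ∈ φ i '' E, ∀ y ∈ φ j '' E, D ≤ dist x y)
    {x : X} (hx : x ∈ E) {e : ℝ} (he : 0 < e) (heD : e ≤ D) :
    ∃ (g : X → X) (r : ℝ), 0 < r ∧ r < 1 ∧ D * r < e ∧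
      (∀ x y, dist (g x) (g y) = r * dist x y) ∧ ball x e ∩ E ⊆ g '' E := by
  obtain ⟨w, y, hy, hye, hyw⟩ := exists_coding hE hx
  have hex : ∃ k, D * prefixRatio ρ w k < e := by
    obtain ⟨k, hk⟩ := exists_prefixRatio_lt hρ hρ1 w (e := e / D) (by positivity)
    exact ⟨k, by rwa [lt_div_iff₀' hD] at hk⟩
  classical
  rcases hk : Nat.find hex with _ | k
  · have := Nat.find_spec hex
    rw [hk, prefixRatio_zero] at this
    linarith
  · have hs := Nat.find_spec hex
    rw [hk] at hs
    have hm := Nat.find_min hex (m := k) (by omega)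
    push Not at hm
    have hR : prefixRatio ρ w (k + 1) < 1 := by
      by_contra! hcon
      have := mul_le_mul_of_nonneg_left hcon hD.le
      linarith
    exact ⟨prefixMap φ w (k + 1), prefixRatio ρ w (k + 1), prefixRatio_pos hρ w _, hR, hs,
      dist_prefixMap hφ w _, fun z hz => mem_prefixMap_image hφ hρ hρ1 hE hD hgap hy hye hyw hz.2 k
        (lt_of_lt_of_le hz.1 hm)⟩

end MetricCoding

/-! ### Hausdorff dimension controls the covering numbers of the attractor -/

section Dimension

variable {X : Type*} [MetricSpace X] {E : Set X}

/-- A set covered by finitely many similar copies of itself, with ratios `r i` such that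
`∑ i, r i ^ t ≤ 1`, has covering exponent `t`. -/
lemma hasBoxBound_of_selfCover (hne : E.Nonempty) (hb : Bornology.IsBounded E) {t : ℝ}
    (ht : 0 ≤ t) {n : ℕ} (g : Fin n → X → X) (r : Fin n → ℝ) (hr : ∀ i, 0 < r i)
    (hr1 : ∀ i, r i < 1) (hg : ∀ i x y, dist (g i x) (g i y) = r i * dist x y)
    (hcov : E ⊆ ⋃ i, g i '' E) (hsum : ∑ i, r i ^ t ≤ 1) : HasBoxBound E t := by
  obtain ⟨rmin, hm0, hm1, hm⟩ := exists_lower_bound hr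
  obtain ⟨rmax, hM0, hM1, hM⟩ := exists_upper_bound_lt_one hr1
  obtain ⟨d0, hd1, hd⟩ : ∃ d : ℝ, 1 ≤ d ∧ ∀ x ∈ E, ∀ y ∈ E, dist x y ≤ d := by
    obtain ⟨d, hd⟩ := Metric.isBounded_iff.1 hb
    exact ⟨max 1 d, le_max_left _ _, fun x hx y hy => (hd hx hy).trans (le_max_right _ _)⟩
  have hd0 : 0 < d0 := by linarith
  have hdm : d0 ≤ d0 / rmin := by
    rw [le_div_iff₀ hm0]; exact mul_le_of_le_one_right hd0.le hm1
  obtain ⟨x0, hx0⟩ := hne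
  have main : ∀ i : ℕ, ∀ δ : ℝ, d0 * rmax ^ i ≤ δ → δ ≤ d0 / rmin →
      ∃ (N : ℕ) (c : X → ℕ), (N : ℝ) ≤ (d0 / rmin) ^ t * δ ^ (-t) ∧
      (∀ x ∈ E, c x < N) ∧ ∀ x ∈ E, ∀ y ∈ E, c x = c y → dist x y ≤ δ := by
    have large : ∀ δ : ℝ, d0 ≤ δ → δ ≤ d0 / rmin →
        ∃ (N : ℕ) (c : X → ℕ), (N : ℝ) ≤ (d0 / rmin) ^ t * δ ^ (-t) ∧
        (∀ x ∈ E, c x < N) ∧ ∀ x ∈ E, ∀ y ∈ E, c x = c y → dist x y ≤ δ := by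
      intro δ h1 h2
      have hδ : 0 < δ := by linarith
      refine ⟨1, fun _ => 0, ?_, by simp, fun x hx y hy _ => (hd x hx y hy).trans h1⟩
      rw [Real.rpow_neg hδ.le, ← div_eq_mul_inv, ← Real.div_rpow (by positivity) hδ.le]
      simpa using Real.one_le_rpow ((one_le_div hδ).2 h2) ht
    intro i
    induction i with
    | zero => intro δ h1 h2; exact large δ (by simpa using h1) h2
    | succ i ih =>
      intro δ h1 h2
      rcases le_or_gt d0 δ with h3 | h3
      · exact large δ h3 h2
      have hδ : 0 < δ := lt_of_lt_of_le (by positivity) h1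
      have hj : ∀ j, ∃ (N : ℕ) (c : X → ℕ), (N : ℝ) ≤ (d0 / rmin) ^ t * (δ / r j) ^ (-t) ∧
          (∀ x ∈ E, c x < N) ∧ ∀ x ∈ E, ∀ y ∈ E, c x = c y → dist x y ≤ δ / r j := by
        intro j
        refine ih (δ / r j) ?_ ?_
        · rw [le_div_iff₀ (hr j)]
          refine le_trans ?_ h1
          rw [pow_succ, mul_assoc]
          gcongr
          exact hM j
        · exact div_le_div₀ hd0.le h3.le hm0 (hm j)
      choose N c hN hc hcd using hj
      have hl : ∀ x ∈ E, ∃ l : (Σ j, Fin (N j)), ∃ y ∈ E, x = g l.1 y ∧ c l.1 y = l.2 := by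
        intro x hx
        obtain ⟨j, y, hy, rfl⟩ := Set.mem_iUnion.1 (hcov hx)
        exact ⟨⟨j, ⟨c j y, hc j y hy⟩⟩, y, hy, rfl, rfl⟩
      have : Nonempty (Σ j, Fin (N j)) := ⟨(hl x0 hx0).choose⟩
      choose! l hl using hl
      refine ⟨∑ j, N j, fun x => (finSigmaFinEquiv (l x) : ℕ), ?_, fun x _ => Fin.is_lt _, ?_⟩
      · push_cast
        calc ∑ j, (N j : ℝ) ≤ ∑ j, (d0 / rmin) ^ t * (δ / r j) ^ (-t) :=
              Finset.sum_le_sum fun j _ => hN j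
          _ = ((d0 / rmin) ^ t * δ ^ (-t)) * ∑ j, r j ^ t := by
              rw [Finset.mul_sum]
              refine Finset.sum_congr rfl fun j _ => ?_
              rw [Real.div_rpow hδ.le (hr j).le, Real.rpow_neg (hr j).le, div_inv_eq_mul, mul_assoc]
          _ ≤ ((d0 / rmin) ^ t * δ ^ (-t)) * 1 := by gcongr
          _ = _ := mul_one _
      · intro x hx y hy hxy
        have hlxy : l x = l y := finSigmaFinEquiv.injective (Fin.ext hxy)
        obtain ⟨x', hx', hxe, hxc⟩ := hl x hx
        obtain ⟨y', hy', hye, hyc⟩ := hl y hy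
        rw [hlxy] at hxe hxc
        have := hcd _ x' hx' y' hy' (hxc.trans hyc.symm)
        rwa [le_div_iff₀' (hr _), ← hg, ← hxe, ← hye] at this
  refine ⟨(d0 / rmin) ^ t, by positivity, fun δ h0 h1 => ?_⟩
  obtain ⟨i, hi⟩ := exists_pow_lt_of_lt_one (show 0 < δ / d0 by positivity) hM1
  rw [lt_div_iff₀' hd0] at hi
  exact main i δ hi.le (by linarith)

/-- A compact null set for the `t`-dimensional Hausdorff measure is covered by finitely many
balls centred on it whose radii have an arbitrarily small sum of `t`-th powers. -/
lemma exists_finite_ball_cover [MeasurableSpace X] [BorelSpace X] (hE : IsCompact E)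
    (hne : E.Nonempty) {t : ℝ} (ht : 0 < t) (hnull : μH[t] E = 0) {D : ℝ} (hD : 0 < D) :
    ∃ (n : ℕ) (x : Fin n → X) (e : Fin n → ℝ), (∀ i, x i ∈ E) ∧ (∀ i, 0 < e i ∧ e i ≤ D) ∧
      E ⊆ (⋃ i, ball (x i) (e i)) ∧ ∑ i, e i ^ t ≤ D ^ t := by
  set ε : ℝ := D ^ t / (2 * 2 ^ t) with hε
  have hε0 : 0 < ε := by positivity
  rw [Measure.hausdorffMeasure_apply] at hnull
  have h1 := (ENNReal.iSup_eq_zero.1 hnull) (ENNReal.ofReal (D / 2))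
  have h2 := (ENNReal.iSup_eq_zero.1 h1) (by simpa using hD)
  have h3 := h2.trans_lt (show (0 : ℝ≥0∞) < ENNReal.ofReal ε by simpa using hε0)
  simp only [iInf_lt_iff] at h3
  obtain ⟨U, hU, hUd, hUs⟩ := h3
  have hfin : ∀ n, ediam (U n) ≠ ∞ := fun n => ((hUd n).trans_lt ENNReal.ofReal_lt_top).ne
  set d : ℕ → ℝ := fun n => (ediam (U n)).toReal with hd
  have hdD : ∀ n, d n ≤ D / 2 := fun n => ENNReal.toReal_le_of_le_ofReal (by positivity) (hUd n)
  have hd0 : ∀ n, 0 ≤ d n := fun n => ENNReal.toReal_nonneg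
  have hds : ∀ s : Finset ℕ, ∑ n ∈ s, d n ^ t ≤ ε := by
    intro s
    have hle : ∑ n ∈ s, ediam (U n) ^ t ≤ ENNReal.ofReal ε := by
      refine le_trans ?_ hUs.le
      refine le_trans (Finset.sum_le_sum fun n _ => ?_) (ENNReal.sum_le_tsum s)
      rcases (U n).eq_empty_or_nonempty with he | he
      · simp [he, ht]
      · exact le_iSup (fun _ : (U n).Nonempty => ediam (U n) ^ t) he
    have := ENNReal.toReal_le_of_le_ofReal hε0.le hle
    rw [ENNReal.toReal_sum (fun n _ => ENNReal.rpow_ne_top_of_nonneg ht.le (hfin n))] at this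
    simpa [hd, ENNReal.toReal_rpow] using this
  -- enlarge the radii a little so that the covering sets become open balls
  set τ : ℕ → ℝ := fun n => D * ((1 / 2 : ℝ) ^ (n + 2)) ^ (1 / t) with hτ
  have hτ0 : ∀ n, 0 < τ n := fun n => by positivity
  have hτD : ∀ n, τ n ≤ D := fun n => mul_le_of_le_one_right hD.le
    (Real.rpow_le_one (by positivity) (pow_le_one₀ (by norm_num) (by norm_num)) (by positivity))
  have hτt : ∀ n, τ n ^ t = D ^ t * (1 / 2) ^ (n + 2) := fun n => by
    rw [hτ, Real.mul_rpow hD.le (by positivity), ← Real.rpow_mul (by positivity),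
      one_div_mul_cancel ht.ne', Real.rpow_one]
  obtain ⟨x0, hx0⟩ := hne
  have hc : ∀ n, ∃ x ∈ E, ((U n ∩ E).Nonempty → x ∈ U n) := fun n => by
    by_cases h : (U n ∩ E).Nonempty
    · exact ⟨h.choose, h.choose_spec.2, fun _ => h.choose_spec.1⟩
    · exact ⟨x0, hx0, fun h' => absurd h' h⟩
  choose x hxE hxU using hc
  set e : ℕ → ℝ := fun n => max (2 * d n) (τ n) with he
  have hcov : E ⊆ ⋃ n, ball (x n) (e n) := by
    intro z hz
    obtain ⟨n, hn⟩ := Set.mem_iUnion.1 (hU hz)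
    refine Set.mem_iUnion.2 ⟨n, ?_⟩
    have hxn := hxU n ⟨z, hn, hz⟩
    have hdist : dist z (x n) ≤ d n := by
      rw [dist_edist]
      exact ENNReal.toReal_mono (hfin n) (edist_le_ediam_of_mem hn hxn)
    refine mem_ball.2 (hdist.trans_lt ?_)
    rcases (hd0 n).eq_or_lt with h0 | h0
    · rw [← h0]; exact (hτ0 n).trans_le (le_max_right _ _)
    · exact lt_of_lt_of_le (by linarith) (le_max_left _ _)
  obtain ⟨s, hs⟩ := hE.elim_finite_subcover _ (fun n => isOpen_ball) hcov
  refine ⟨s.card, fun i => x (s.equivFin.symm i), fun i => e (s.equivFin.symm i),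
    fun i => hxE _, fun i => ⟨(hτ0 _).trans_le (le_max_right _ _),
      max_le (by linarith [hdD (s.equivFin.symm i)]) (hτD _)⟩, fun z hz => ?_, ?_⟩
  · obtain ⟨n, hns, hn⟩ := Set.mem_iUnion₂.1 (hs hz)
    refine Set.mem_iUnion.2 ⟨s.equivFin ⟨n, hns⟩, ?_⟩
    simpa using hn
  · rw [Equiv.sum_comp s.equivFin.symm (fun n : s => e n ^ t), Finset.sum_coe_sort s fun n => e n ^ t]
    have hgeo : ∑ n ∈ s, (1 / 2 : ℝ) ^ (n + 2) ≤ 1 / 2 := by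
      calc ∑ n ∈ s, (1 / 2 : ℝ) ^ (n + 2) = (1 / 4) * ∑ n ∈ s, (1 / 2 : ℝ) ^ n := by
            rw [Finset.mul_sum]; exact Finset.sum_congr rfl fun n _ => by ring
        _ ≤ (1 / 4) * 2 := by
            gcongr
            exact (summable_geometric_two.sum_le_tsum s fun n _ => by positivity).trans_eq
              tsum_geometric_two
        _ = 1 / 2 := by norm_num
    calc ∑ n ∈ s, e n ^ t ≤ ∑ n ∈ s, (2 ^ t * d n ^ t + D ^ t * (1 / 2) ^ (n + 2)) := by
          refine Finset.sum_le_sum fun n _ => ?_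
          rw [← hτt, ← Real.mul_rpow (by norm_num) (hd0 n)]
          have p1 : 0 ≤ (2 * d n) ^ t := Real.rpow_nonneg (by linarith [hd0 n]) _
          have p2 : 0 ≤ τ n ^ t := Real.rpow_nonneg (hτ0 n).le _
          rcases max_choice (2 * d n) (τ n) with h | h <;> simp only [he, h] <;> linarith
      _ = 2 ^ t * ∑ n ∈ s, d n ^ t + D ^ t * ∑ n ∈ s, (1 / 2 : ℝ) ^ (n + 2) := by
          rw [Finset.sum_add_distrib, Finset.mul_sum, Finset.mul_sum]
      _ ≤ 2 ^ t * ε + D ^ t * (1 / 2) := by gcongr; exact hds s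
      _ = D ^ t := by rw [hε]; field_simp; norm_num

/-- Under strong separation, every exponent above the Hausdorff dimension of the attractor bounds
its covering numbers. -/
lemma hasBoxBound_of_dimH_lt {ℓ : ℕ} {φ : Fin ℓ → X → X} {ρ : Fin ℓ → ℝ}
    (hφ : ∀ i x y, dist (φ i x) (φ i y) = ρ i * dist x y)
    (hρ : ∀ i, 0 < ρ i) (hρ1 : ∀ i, ρ i < 1) (hcomp : IsCompact E) (hne : E.Nonempty)
    (hE : E ⊆ ⋃ i, φ i '' E) {D : ℝ} (hD : 0 < D)
    (hgap : ∀ i j, i ≠ j → ∀ x ∈ φ i '' E, ∀ y ∈ φ j '' E, D ≤ dist x y)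
    {t : ℝ≥0} (ht : dimH E < t) : HasBoxBound E t := by
  have ht0 : (0 : ℝ) < t := by
    have : (0 : ℝ≥0∞) < t := lt_of_le_of_lt zero_le ht
    exact_mod_cast this
  borelize X
  obtain ⟨n, x, e, hx, he, hcov, hsum⟩ := exists_finite_ball_cover hcomp hne ht0
    (hausdorffMeasure_of_dimH_lt ht) hD
  have hcyl := fun i => exists_cylinder_of_ball hφ hρ hρ1 hE hD hgap (hx i) (he i).1 (he i).2
  choose g r hr hr1 hre hg hball using hcyl
  refine hasBoxBound_of_selfCover hne hcomp.isBounded ht0.le g r hr hr1 hg (fun z hz => ?_) ?_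
  · obtain ⟨i, hi⟩ := Set.mem_iUnion.1 (hcov hz)
    exact Set.mem_iUnion.2 ⟨i, hball i ⟨hi, hz⟩⟩
  · have hDt : (0 : ℝ) < D ^ (t : ℝ) := by positivity
    rw [← mul_le_mul_iff_right₀ hDt, mul_one, Finset.mul_sum]
    refine le_trans (Finset.sum_le_sum fun i _ => ?_) hsum
    rw [← Real.mul_rpow hD.le (hr i).le]
    exact Real.rpow_le_rpow (mul_nonneg hD.le (hr i).le) (hre i).le ht0.le

end Dimension

/-! ### Renormalized distances along an embedding -/

/-- The set of distances between points of `E`. -/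
def distSet {X : Type*} [PseudoMetricSpace X] (E : Set X) : Set ℝ :=
  (fun p : X × X => dist p.1 p.2) '' E ×ˢ E

lemma HasBoxBound.distSet {X : Type*} [PseudoMetricSpace X] {E : Set X} {t : ℝ}
    (hE : HasBoxBound E t) : HasBoxBound (distSet E) (2 * t) := by
  rw [two_mul]
  refine (hE.prod hE).image _ 2 (by norm_num) fun p _ q _ => ?_
  have h := dist_dist_dist_le p.1 p.2 q.1 q.2
  have h1 : dist p.1 q.1 ≤ dist p q := le_max_left _ _
  have h2 : dist p.2 q.2 ≤ dist p q := le_max_right _ _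
  linarith

lemma iterate_similitude_sub {V : Type*} [NormedAddCommGroup V] [NormedSpace ℝ V]
    {ψ : V → V} {γ : ℝ} {P : V ≃ₗᵢ[ℝ] V} {b : V} (hψ : ∀ x, ψ x = γ • P x + b) (n : ℕ) (x y : V) :
    ψ^[n] x - ψ^[n] y = γ ^ n • P^[n] (x - y) := by
  induction n with
  | zero => simp
  | succ n ih =>
    rw [Function.iterate_succ_apply', Function.iterate_succ_apply', Function.iterate_succ_apply',
      hψ, hψ, add_sub_add_right_eq_sub, ← smul_sub, ← map_sub, ih, map_smul, smul_smul, pow_succ']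

/-- Let `x ↦ M x + a` embed `F` in `E`, and let the similitude `ψ = γ P + b` map `F` to itself.
The images of `ψ^[m] F` shrink to a point of `E`; blowing them up along the cylinders of `E` around
this point, coded by `w`, turns the difference `v` of two points of `F` into distances of `E`. -/
lemma exists_renormalized_distances {V : Type*} [NormedAddCommGroup V] [NormedSpace ℝ V]
    [CompleteSpace V] {ℓ : ℕ} {φ : Fin ℓ → V → V} {ρ : Fin ℓ → ℝ} {E F : Set V}
    (hφ : ∀ i x y, dist (φ i x) (φ i y) = ρ i * dist x y)
    (hρ : ∀ i, 0 < ρ i) (hρ1 : ∀ i, ρ i < 1)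
    (hE : E ⊆ ⋃ i, φ i '' E) {D : ℝ} (hD : 0 < D)
    (hgap : ∀ i j, i ≠ j → ∀ x ∈ φ i '' E, ∀ y ∈ φ j '' E, D ≤ dist x y)
    {ψ : V → V} {γ : ℝ} (hγ : 0 < γ) (hγ1 : γ < 1) {P : V ≃ₗᵢ[ℝ] V} {b : V}
    (hψ : ∀ x, ψ x = γ • P x + b) (hF : IsCompact F) (hFψ : ∀ x ∈ F, ψ x ∈ F)
    (hFnt : F.Nontrivial) {M : V →L[ℝ] V} {a : V} (hM : ∀ x ∈ F, M x + a ∈ E) :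
    ∃ (w : ℕ → Fin ℓ) (v : V), v ≠ 0 ∧ ∀ k m : ℕ, γ ^ m ≤ prefixRatio ρ w k →
      γ ^ m / prefixRatio ρ w k * ‖M (P^[m] v)‖ ∈ distSet E := by
  obtain ⟨x1, hx1, x2, hx2, hne⟩ := hFnt
  -- the fixed point of `ψ` in `F`
  obtain ⟨z, hzF, hz⟩ : ∃ z ∈ F, ψ z = z := by
    have hmaps : Set.MapsTo ψ F F := hFψ
    have hc : ContractingWith ⟨γ, hγ.le⟩ (hmaps.restrict ψ F F) := by
      refine ⟨by exact_mod_cast hγ1, LipschitzWith.of_dist_le_mul fun x y => ?_⟩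
      have h := iterate_similitude_sub hψ 1 (x : V) y
      simp only [Function.iterate_one, pow_one] at h
      rw [Subtype.dist_eq, Set.MapsTo.val_restrict_apply, Set.MapsTo.val_restrict_apply, dist_eq_norm,
        h, norm_smul, P.norm_map, Real.norm_of_nonneg hγ.le, ← dist_eq_norm]
      rfl
    obtain ⟨z, hz, hfix, -⟩ := hc.exists_fixedPoint' hF.isComplete hmaps hx1 (edist_ne_top _ _)
    exact ⟨z, hz, hfix⟩
  have hzn : ∀ n, ψ^[n] z = z := fun n => Function.iterate_fixed hz n
  have hFn : ∀ n, ∀ x ∈ F, ψ^[n] x ∈ F := fun n => by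
    induction n with
    | zero => exact fun x hx => hx
    | succ n ih => intro x hx; rw [Function.iterate_succ_apply']; exact hFψ _ (ih x hx)
  have hPn : ∀ n x, ‖P^[n] x‖ = ‖x‖ := fun n x => by
    induction n with
    | zero => rfl
    | succ n ih => rw [Function.iterate_succ_apply', P.norm_map, ih]
  obtain ⟨w, y, hy, hye, hyw⟩ := exists_coding hE (hM z hzF)
  set R := ‖x1 - z‖ + ‖x2 - z‖ with hR
  -- after `m0` steps the copies of `F` are small compared with the gap of `E`
  obtain ⟨m0, hm0⟩ := exists_pow_lt_of_lt_one (show 0 < D / ((‖M‖ + 1) * (R + 1)) by positivity) hγ1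
  rw [lt_div_iff₀ (by positivity)] at hm0
  have hclose : ∀ x, ‖x - z‖ ≤ R → x ∈ F → ∀ k m, γ ^ m ≤ prefixRatio ρ w k →
      M (ψ^[m + m0] x) + a ∈ prefixMap φ w k '' E := by
    intro x hxR hxF k m hk
    have hlt : dist (M (ψ^[m + m0] x) + a) (M z + a) < D * prefixRatio ρ w k := by
      have hdiff := iterate_similitude_sub hψ (m + m0) x z
      rw [hzn] at hdiff
      rw [dist_add_right, dist_eq_norm, ← map_sub, hdiff]
      calc ‖M (γ ^ (m + m0) • P^[m + m0] (x - z))‖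
          ≤ ‖M‖ * ‖γ ^ (m + m0) • P^[m + m0] (x - z)‖ := M.le_opNorm _
        _ = ‖M‖ * (γ ^ (m + m0) * ‖x - z‖) := by
            rw [norm_smul, hPn, Real.norm_of_nonneg (by positivity)]
        _ ≤ (‖M‖ + 1) * (γ ^ (m + m0) * (R + 1)) := by gcongr <;> linarith
        _ = γ ^ m * (γ ^ m0 * ((‖M‖ + 1) * (R + 1))) := by ring
        _ < γ ^ m * D := by gcongr
        _ ≤ D * prefixRatio ρ w k := by rw [mul_comm]; gcongr
    rcases k with _ | k
    · exact ⟨_, hM _ (hFn _ x hxF), rfl⟩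
    · exact mem_prefixMap_image hφ hρ hρ1 hE hD hgap hy hye hyw (hM _ (hFn _ x hxF)) k
        (hlt.trans_le (mul_le_mul_of_nonneg_left (prefixRatio_succ_le hρ hρ1 w k) hD.le))
  refine ⟨w, γ ^ m0 • P^[m0] (x1 - x2), ?_, fun k m hk => ?_⟩
  · refine smul_ne_zero (by positivity) fun h0 => hne ?_
    rw [← norm_eq_zero, hPn, norm_eq_zero, sub_eq_zero] at h0
    exact h0
  · obtain ⟨u1, hu1, e1⟩ := hclose x1 (by simp [hR]) hx1 k m hk
    obtain ⟨u2, hu2, e2⟩ := hclose x2 (by simp [hR]) hx2 k m hk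
    refine ⟨(u1, u2), ⟨hu1, hu2⟩, ?_⟩
    have hpos := prefixRatio_pos hρ w k
    have hPs : ∀ (n : ℕ) (c : ℝ) (x : V), P^[n] (c • x) = c • P^[n] x := fun n c x => by
      induction n with
      | zero => rfl
      | succ n ih => rw [Function.iterate_succ_apply', Function.iterate_succ_apply', ih, map_smul]
    have h := dist_prefixMap hφ w k u1 u2
    rw [e1, e2, dist_add_right, dist_eq_norm, ← map_sub, iterate_similitude_sub hψ, map_smul,
      norm_smul, Real.norm_of_nonneg (by positivity)] at h
    rw [hPs, map_smul, norm_smul, Real.norm_of_nonneg (by positivity), ← Function.iterate_add_apply]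
    simp only
    rw [div_mul_eq_mul_div, eq_div_iff hpos.ne', mul_comm, ← h]
    ring

/-! ### Rotations have no small subgroups -/

/-- In a normed algebra, an element all of whose powers are close to `1` is `1`: squaring
multiplies the distance to `1` by at least `3 / 2` as long as that distance is at most `1 / 2`. -/
lemma eq_one_of_norm_pow_sub_one_le {A : Type*} [NormedRing A] [NormedAlgebra ℝ A] (x : A)
    (h : ∀ n : ℕ, ‖x ^ n - 1‖ ≤ 1 / 2) : x = 1 := by
  have hsq : ∀ y : A, ‖y - 1‖ ≤ 1 / 2 → (3 / 2) * ‖y - 1‖ ≤ ‖y ^ 2 - 1‖ := by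
    intro y hy
    have e : y ^ 2 - 1 = (2 : ℝ) • (y - 1) + (y - 1) * (y - 1) := by
      rw [two_smul]; noncomm_ring
    have h1 : ‖(2 : ℝ) • (y - 1)‖ = 2 * ‖y - 1‖ := by rw [norm_smul]; norm_num
    have h2 := norm_mul_le (y - 1) (y - 1)
    have h3 := norm_sub_le_norm_add ((2 : ℝ) • (y - 1)) ((y - 1) * (y - 1))
    rw [e]
    nlinarith [norm_nonneg (y - 1)]
  have hgrow : ∀ k : ℕ, (3 / 2 : ℝ) ^ k * ‖x - 1‖ ≤ ‖x ^ 2 ^ k - 1‖ := by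
    intro k
    induction k with
    | zero => simp
    | succ k ih =>
      have := hsq (x ^ 2 ^ k) (h _)
      rw [← pow_mul, ← pow_succ] at this
      rw [pow_succ]
      linarith
  by_contra hne
  have hpos : 0 < ‖x - 1‖ := norm_pos_iff.2 (sub_ne_zero.2 hne)
  obtain ⟨k, hk⟩ := pow_unbounded_of_one_lt (1 / ‖x - 1‖) (by norm_num : (1 : ℝ) < 3 / 2)
  rw [div_lt_iff₀ hpos] at hk
  linarith [hgrow k, h (2 ^ k)]

/-- A vector with finite-dimensional orbit under a linear contraction `T` that is returned
arbitrarily close to itself by all powers of some `T ^ p` is fixed by some `T ^ p`. -/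
lemma exists_pow_apply_eq {X : Type*} [NormedAddCommGroup X] [NormedSpace ℝ X] (T : X →L[ℝ] X)
    (hT : ∀ x, ‖T x‖ ≤ ‖x‖) (f : X)
    (hfin : FiniteDimensional ℝ (Submodule.span ℝ (Set.range fun i : ℕ => (T ^ i) f)))
    (h : ∀ ε > 0, ∃ p : ℕ, 1 ≤ p ∧ ∀ j : ℕ, ‖(T ^ (p * j)) f - f‖ ≤ ε) :
    ∃ p : ℕ, 1 ≤ p ∧ (T ^ p) f = f := by
  set U := Submodule.span ℝ (Set.range fun i : ℕ => (T ^ i) f) with hU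
  have hTn : ∀ n x, ‖(T ^ n) x‖ ≤ ‖x‖ := fun n x => by
    induction n with
    | zero => simp
    | succ n ih => rw [pow_succ', mul_apply_eq_comp]; exact (hT _).trans ih
  have hTU : ∀ x ∈ U, T x ∈ U := fun x hx => by
    have hle : U ≤ U.comap (T : X →ₗ[ℝ] X) := by
      rw [hU, Submodule.span_le]
      rintro _ ⟨i, rfl⟩
      refine Submodule.subset_span ⟨i + 1, ?_⟩
      simp only [pow_succ', mul_apply_eq_comp]
      rfl
    exact hle hx
  let S : U →L[ℝ] U := LinearMap.toContinuousLinearMap ((T : X →ₗ[ℝ] X).restrict hTU)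
  have hS : ∀ (n : ℕ) (u : U), ((S ^ n) u : X) = (T ^ n) u := fun n u => by
    induction n with
    | zero => simp
    | succ n ih =>
      rw [pow_succ', pow_succ', mul_apply_eq_comp, mul_apply_eq_comp, ← ih]
      rfl
  let v : ℕ → U := fun i => ⟨(T ^ i) f, Submodule.subset_span ⟨i, rfl⟩⟩
  have hv : ⊤ ≤ Submodule.span ℝ (Set.range v) := by
    intro u _
    have hmap : (Submodule.span ℝ (Set.range v)).map U.subtype = U := by
      rw [Submodule.map_span, ← Set.range_comp]
      rfl
    obtain ⟨u', hu', he⟩ : (u : X) ∈ (Submodule.span ℝ (Set.range v)).map U.subtype := by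
      rw [hmap]; exact u.2
    rwa [← Subtype.ext he]
  let b := Module.Basis.ofSpan hv
  have : Finite _ := Module.Finite.finite_basis b
  obtain ⟨C, hC, hCb⟩ := b.exists_opNorm_le (F := U)
  obtain ⟨p, hp, hpj⟩ := h (1 / (2 * C)) (by positivity)
  have hpow : ∀ j : ℕ, ‖(S ^ p) ^ j - 1‖ ≤ 1 / 2 := by
    intro j
    refine (hCb (M := 1 / (2 * C)) (by positivity) fun i => ?_).trans_eq (by field_simp)
    obtain ⟨k, hk⟩ := Module.Basis.ofSpan_subset hv ⟨i, rfl⟩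
    change v k = b i at hk
    rw [← hk, ← pow_mul]
    have e : (((S ^ (p * j) - 1) (v k) : U) : X) = (T ^ k) ((T ^ (p * j)) f - f) := by
      rw [map_sub, ← mul_apply_eq_comp, ← pow_add, add_comm k, pow_add]
      change ((S ^ (p * j)) (v k) : X) - (v k : X) = _
      rw [hS]
      rfl
    change ‖(((S ^ (p * j) - 1) (v k) : U) : X)‖ ≤ _
    rw [e]
    exact (hTn _ _).trans (hpj j)
  have h1 := eq_one_of_norm_pow_sub_one_le (A := U →L[ℝ] U) _ hpow
  refine ⟨p, hp, ?_⟩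
  have h2 := hS p (v 0)
  rw [h1] at h2
  simpa [v] using h2.symm

section Orbit

variable {V : Type*} [NormedAddCommGroup V] [InnerProductSpace ℝ V] [FiniteDimensional ℝ V]

/-- If `m ↦ ‖M (P ^ m v)‖²` is uniformly close to itself along the multiples of suitable shifts,
then it is periodic. -/
lemma exists_period_of_almost_period (M : V →L[ℝ] V) (P : V ≃ₗᵢ[ℝ] V) (v : V)
    (h : ∀ ε > 0, ∃ p : ℕ, 1 ≤ p ∧ ∀ j m : ℕ,
      |‖M (P^[m + p * j] v)‖ ^ 2 - ‖M (P^[m] v)‖ ^ 2| ≤ ε) :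
    ∃ p : ℕ, 1 ≤ p ∧ ∀ m, ‖M (P^[m + p] v)‖ = ‖M (P^[m] v)‖ := by
  have hPn : ∀ n x, ‖P^[n] x‖ = ‖x‖ := fun n x => by
    induction n with
    | zero => rfl
    | succ n ih => rw [Function.iterate_succ_apply', P.norm_map, ih]
  -- quadratic forms, evaluated along the orbit of `v`
  let Φ : (V →L[ℝ] V) →ₗ[ℝ] (ℕ →ᵇ ℝ) :=
    { toFun := fun B => BoundedContinuousFunction.ofNormedAddCommGroupDiscrete
        (fun n => ⟪B (P^[n] v), P^[n] v⟫) (‖B‖ * ‖v‖ * ‖v‖) (fun n => by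
          refine (norm_inner_le_norm _ _).trans ?_
          rw [hPn]
          gcongr
          exact (B.le_opNorm _).trans_eq (by rw [hPn]))
      map_add' := fun B C => by ext n; simp [inner_add_left]
      map_smul' := fun c B => by ext n; simp [inner_smul_left] }
  let T : (ℕ →ᵇ ℝ) →L[ℝ] (ℕ →ᵇ ℝ) := LinearMap.mkContinuous
    { toFun := fun f => f.compContinuous ⟨fun n => n + 1, continuous_of_discreteTopology⟩
      map_add' := fun f g => by ext n; rfl
      map_smul' := fun c f => by ext n; rfl } 1 (fun f => by
        rw [one_mul]
        exact (BoundedContinuousFunction.norm_le (norm_nonneg _)).2 fun n => f.norm_coe_le_norm _)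
  have hT1 : ∀ (f : ℕ →ᵇ ℝ) (n : ℕ), T f n = f (n + 1) := fun f n => rfl
  have hTi : ∀ (i : ℕ) (f : ℕ →ᵇ ℝ) (n : ℕ), (T ^ i) f n = f (n + i) := fun i f n => by
    induction i generalizing n with
    | zero => simp
    | succ i ih =>
      rw [pow_succ', mul_apply_eq_comp, hT1, ih]
      congr 1
      ring
  let Q : ℕ → (V →L[ℝ] V) := fun i => M ∘L ((P : V →L[ℝ] V) ^ i)
  have hQ : ∀ i x, Q i x = M (P^[i] x) := fun i x => by
    simp only [Q, ContinuousLinearMap.comp_apply, FunLike.coe_pow_eq_iterate]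
    rfl
  let f : ℕ →ᵇ ℝ := Φ ((Q 0).adjoint ∘L Q 0)
  have hΦ : ∀ i n, Φ ((Q i).adjoint ∘L Q i) n = ‖M (P^[n + i] v)‖ ^ 2 := fun i n => by
    change ⟪(Q i).adjoint (Q i (P^[n] v)), P^[n] v⟫ = _
    rw [ContinuousLinearMap.adjoint_inner_left, real_inner_self_eq_norm_sq, hQ,
      ← Function.iterate_add_apply, add_comm]
  have hf : ∀ n, f n = ‖M (P^[n] v)‖ ^ 2 := fun n => hΦ 0 n
  have hfin : FiniteDimensional ℝ (Submodule.span ℝ (Set.range fun i : ℕ => (T ^ i) f)) := by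
    refine Submodule.finiteDimensional_of_le (S₂ := LinearMap.range Φ) ?_
    rw [Submodule.span_le]
    rintro _ ⟨i, rfl⟩
    refine ⟨(Q i).adjoint ∘L Q i, ?_⟩
    ext n
    rw [hΦ, hTi, hf]
  obtain ⟨p, hp, hpf⟩ := exists_pow_apply_eq T
    (fun f => (BoundedContinuousFunction.norm_le (norm_nonneg _)).2 fun n => f.norm_coe_le_norm _)
    f hfin (fun ε hε => by
      obtain ⟨p, hp, hpj⟩ := h ε hε
      refine ⟨p, hp, fun j => (BoundedContinuousFunction.norm_le hε.le).2 fun m => ?_⟩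
      have := hpj j m
      rwa [← hf, ← hf, ← hTi] at this)
  refine ⟨p, hp, fun m => ?_⟩
  have h1 : (T ^ p) f m = f m := by rw [hpf]
  rw [hTi, hf, hf] at h1
  exact (pow_left_inj₀ (norm_nonneg _) (norm_nonneg _) two_ne_zero).1 h1

end Orbit

/-! ### Thin distance sets force the rotation to act periodically -/

lemma abs_div_sub_div_le {x x' y y' c B : ℝ} (hc : 0 < c) (hx : c ≤ x) (hx' : c ≤ x')
    (hy' : |y'| ≤ B) : |y / x - y' / x'| ≤ |y - y'| / c + B * |x - x'| / c ^ 2 := by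
  have h1 : 0 < x := by linarith
  have h2 : 0 < x' := by linarith
  have hB : 0 ≤ B := (abs_nonneg _).trans hy'
  have e : y / x - y' / x' = (y - y') / x + y' * (x' - x) / (x * x') := by field_simp; ring
  rw [e]
  refine (abs_add_le _ _).trans (add_le_add ?_ ?_)
  · rw [abs_div, abs_of_pos h1]; gcongr
  · rw [abs_div, abs_mul, abs_of_pos (mul_pos h1 h2), abs_sub_comm x' x, sq]
    gcongr

lemma HasBoxBound.ratio {S : Set ℝ} {s : ℝ} (hS : HasBoxBound S s) {B : ℝ}
    (hB : ∀ x ∈ S, |x| ≤ B) {c : ℝ} (hc : 0 < c) :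
    HasBoxBound {z : ℝ | ∃ x ∈ S, ∃ y ∈ S, c ≤ x ∧ z = y / x} (s + s) := by
  rcases S.eq_empty_or_nonempty with he | ⟨x0, hx0⟩
  · exact ⟨1, one_pos, fun δ h0 h1 => ⟨0, fun _ => 0, by simp only [Nat.cast_zero]; positivity,
      by simp [he], by simp [he]⟩⟩
  have hB0 : 0 ≤ B := (abs_nonneg _).trans (hB x0 hx0)
  have h := ((hS.prod hS).mono (B := {p : ℝ × ℝ | p ∈ S ×ˢ S ∧ c ≤ p.1}) fun p hp => hp.1).image
    (fun p => p.2 / p.1) (1 / c + B / c ^ 2) (by positivity) fun p hp q hq => by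
      have h1 : |p.1 - q.1| ≤ dist p q := by rw [← Real.dist_eq]; exact le_max_left _ _
      have h2 : |p.2 - q.2| ≤ dist p q := by rw [← Real.dist_eq]; exact le_max_right _ _
      rw [Real.dist_eq]
      refine (abs_div_sub_div_le (y := p.2) hc hp.2 hq.2 (hB _ hq.1.2)).trans ?_
      calc |p.2 - q.2| / c + B * |p.1 - q.1| / c ^ 2
          ≤ dist p q / c + B * dist p q / c ^ 2 := by gcongr
        _ = (1 / c + B / c ^ 2) * dist p q := by ring
  refine h.mono ?_
  rintro z ⟨x, hx, y, hy, hcx, rfl⟩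
  exact ⟨(x, y), ⟨⟨hx, hy⟩, hcx⟩, rfl⟩

/-- If the growth ratios of a bounded sequence over a shift are almost constant, then they are
almost `1`. -/
lemma abs_ratio_sub_one_le {a : ℕ → ℝ} {c B ε : ℝ} (hc : 0 < c) (hca : ∀ m, c ≤ a m)
    (haB : ∀ m, a m ≤ B) (hε : 0 < ε) (p : ℕ)
    (h : ∀ n m, |a (n + p) / a n - a (m + p) / a m| ≤ ε) (m : ℕ) :
    |a (m + p) / a m - 1| ≤ 2 * ε := by
  have hpos : ∀ m, 0 < a m := fun m => hc.trans_le (hca m)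
  have hB : 0 < B := (hpos 0).trans_le (haB 0)
  rw [abs_le]
  constructor
  · by_contra! hcon
    have hn : ∀ n, a (n + p) ≤ (1 - ε) * a n := fun n => by
      have := (abs_le.1 (h n m)).2
      rw [← div_le_iff₀ (hpos n)]
      linarith
    have hε1 : 0 < 1 - ε := by
      have h1 := hn 0
      have h2 := hpos (0 + p)
      by_contra! h3
      nlinarith [hpos 0]
    have hit : ∀ t : ℕ, a (t * p) ≤ (1 - ε) ^ t * a 0 := fun t => by
      induction t with
      | zero => simp
      | succ t ih =>
        rw [Nat.succ_mul, pow_succ']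
        calc a (t * p + p) ≤ (1 - ε) * a (t * p) := hn _
          _ ≤ (1 - ε) * ((1 - ε) ^ t * a 0) := by gcongr
          _ = _ := by ring
    obtain ⟨t, ht⟩ := exists_pow_lt_of_lt_one (show 0 < c / a 0 from div_pos hc (hpos 0))
      (show 1 - ε < 1 by linarith)
    rw [lt_div_iff₀ (hpos 0)] at ht
    linarith [hit t, hca (t * p)]
  · by_contra! hcon
    have hn : ∀ n, (1 + ε) * a n ≤ a (n + p) := fun n => by
      have := (abs_le.1 (h n m)).1
      rw [← le_div_iff₀ (hpos n)]
      linarith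
    have hit : ∀ t : ℕ, (1 + ε) ^ t * a 0 ≤ a (t * p) := fun t => by
      induction t with
      | zero => simp
      | succ t ih =>
        rw [Nat.succ_mul, pow_succ']
        calc (1 + ε) * (1 + ε) ^ t * a 0 = (1 + ε) * ((1 + ε) ^ t * a 0) := by ring
          _ ≤ (1 + ε) * a (t * p) := by gcongr
          _ ≤ _ := hn _
    obtain ⟨t, ht⟩ := pow_unbounded_of_one_lt (B / a 0) (show 1 < 1 + ε by linarith)
    rw [div_lt_iff₀ (hpos 0)] at ht
    linarith [hit t, haB (t * p)]

/-- Every positive number at most `1` lies within a bounded factor below a prefix ratio. -/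
lemma exists_prefixRatio_near {ℓ : ℕ} {ρ : Fin ℓ → ℝ} (hρ : ∀ i, 0 < ρ i) (hρ1 : ∀ i, ρ i < 1)
    (w : ℕ → Fin ℓ) {r : ℝ} (hr : ∀ i, r ≤ ρ i) {x : ℝ} (hx : 0 < x) (hx1 : x ≤ 1) :
    ∃ k, x ≤ prefixRatio ρ w k ∧ prefixRatio ρ w k * r ≤ x := by
  classical
  have hex := exists_prefixRatio_lt hρ hρ1 w hx
  rcases hk : Nat.find hex with _ | k
  · have := Nat.find_spec hex
    rw [hk, prefixRatio_zero] at this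
    linarith
  · have hs := Nat.find_spec hex
    rw [hk, prefixRatio_succ] at hs
    have hm := Nat.find_min hex (m := k) (by omega)
    push Not at hm
    exact ⟨k, hm, (mul_le_mul_of_nonneg_left (hr _) (prefixRatio_pos hρ w k).le).trans hs.le⟩

section Orbit

variable {V : Type*} [NormedAddCommGroup V] [InnerProductSpace ℝ V] [FiniteDimensional ℝ V]

/-- The ratios `‖M (P ^ (m + r) v)‖ / ‖M (P ^ m v)‖` are, up to the factor `γ ^ r`, quotients of
elements of `S`, a set of covering exponent below `1 / 2`. Such quotients admit no long chains with
small steps, which makes the sequence `m ↦ ‖M (P ^ m v)‖` almost periodic along the multiples of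
a recurrence time of `P`, and hence periodic. -/
lemma exists_period {ℓ : ℕ} {ρ : Fin ℓ → ℝ} (hρ : ∀ i, 0 < ρ i) (hρ1 : ∀ i, ρ i < 1)
    {w : ℕ → Fin ℓ} {γ : ℝ} (hγ : 0 < γ) (hγ1 : γ < 1) {M : V →L[ℝ] V}
    (hM : Function.Injective M) {P : V ≃ₗᵢ[ℝ] V} {v : V} (hv : v ≠ 0) {S : Set ℝ} {s : ℝ}
    (hS : HasBoxBound S s) (hs : s + s < 1) {B : ℝ} (hB : ∀ x ∈ S, |x| ≤ B)
    (h : ∀ k m : ℕ, γ ^ m ≤ prefixRatio ρ w k →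
      γ ^ m / prefixRatio ρ w k * ‖M (P^[m] v)‖ ∈ S) :
    ∃ p : ℕ, 1 ≤ p ∧ ∀ m, ‖M (P^[m + p] v)‖ = ‖M (P^[m] v)‖ := by
  set q : ℕ → V := fun m => P^[m] v with hq
  have hPd : ∀ n x y, dist (P^[n] x) (P^[n] y) = dist x y := fun n x y => by
    induction n with
    | zero => rfl
    | succ n ih => rw [Function.iterate_succ_apply', Function.iterate_succ_apply', P.dist_map, ih]
  have hqd : ∀ i m n, dist (q (i + m)) (q (i + n)) = dist (q m) (q n) := fun i m n => by
    simp only [hq, Function.iterate_add_apply, hPd]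
  have hqn : ∀ m, ‖q m‖ = ‖v‖ := fun m => by
    have hP0 : P^[m] 0 = 0 := Function.iterate_fixed (map_zero P) m
    rw [← dist_zero_right, ← hP0, hPd, dist_zero_right]
  set a : ℕ → ℝ := fun m => ‖M (q m)‖ with ha
  have haL : ∀ m n, |a m - a n| ≤ ‖M‖ * dist (q m) (q n) := fun m n => by
    refine (abs_norm_sub_norm_le _ _).trans ?_
    rw [← map_sub, dist_eq_norm]
    exact M.le_opNorm _
  obtain ⟨A, hA0, hA⟩ : ∃ A : ℝ, 0 < A ∧ ∀ m, a m ≤ A :=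
    ⟨‖M‖ * ‖v‖ + 1, by positivity, fun m => ((M.le_opNorm _).trans_eq (by rw [hqn])).trans
      (by linarith)⟩
  obtain ⟨c, hc, hca⟩ : ∃ c : ℝ, 0 < c ∧ ∀ m, c ≤ a m := by
    obtain ⟨K, hK, hanti⟩ := LinearMap.exists_antilipschitzWith (M : V →ₗ[ℝ] V)
      (LinearMap.ker_eq_bot.2 hM)
    have hK' : (0 : ℝ) < K := by exact_mod_cast hK
    refine ⟨‖v‖ / K, div_pos (norm_pos_iff.2 hv) hK', fun m => ?_⟩
    rw [div_le_iff₀' hK', ← hqn m]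
    have := hanti.le_mul_dist (q m) 0
    simpa [dist_eq_norm] using this
  have haA : ∀ m, |a m| ≤ A := fun m => by rw [abs_of_nonneg (hc.le.trans (hca m))]; exact hA m
  have hpos : ∀ m, 0 < a m := fun m => hc.trans_le (hca m)
  -- the orbit is totally bounded, hence recurrent
  have hdense : ∀ η > 0, ∃ N : ℕ, ∀ n, ∃ r < N, dist (q n) (q r) < η := by
    intro η hη
    have htb : TotallyBounded (Set.range q) :=
      (isCompact_closedBall (0 : V) ‖v‖).totallyBounded.subset (by
        rintro _ ⟨m, rfl⟩; simp [hqn])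
    obtain ⟨t, hts, htf, htc⟩ := finite_approx_of_totallyBounded htb η hη
    have hts' : ∀ y ∈ t, ∃ r, q r = y := fun y hy => hts hy
    choose! idx hidx using hts'
    obtain ⟨N, hN⟩ := (htf.image idx).bddAbove
    refine ⟨N + 1, fun n => ?_⟩
    obtain ⟨y, hy, hny⟩ := Set.mem_iUnion₂.1 (htc ⟨n, rfl⟩)
    exact ⟨idx y, Nat.lt_succ_of_le (hN ⟨y, hy, rfl⟩), by rw [hidx y hy]; exact hny⟩
  have hrec : ∀ η > 0, ∃ p : ℕ, 1 ≤ p ∧ ∀ m, dist (q (m + p)) (q m) ≤ η := by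
    intro η hη
    obtain ⟨N, hN⟩ := hdense η hη
    obtain ⟨r, hr, hd⟩ := hN N
    refine ⟨N - r, by omega, fun m => ?_⟩
    have h1 := hqd m (N - r) 0
    have h2 := hqd r (N - r) 0
    rw [Nat.add_sub_cancel' hr.le] at h2
    rw [add_zero] at h1 h2
    rw [h1, ← h2]
    exact hd.le
  obtain ⟨rm, hrm0, -, hrm⟩ := exists_lower_bound hρ
  set X : Set ℝ := {z : ℝ | ∃ x ∈ S, ∃ y ∈ S, rm * c ≤ x ∧ z = y / x} with hX
  have hXb : HasBoxBound X (s + s) := hS.ratio hB (mul_pos hrm0 hc)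
  have hXm : ∀ r m, γ ^ r * (a (m + r) / a m) ∈ X := by
    intro r m
    obtain ⟨k, hk1, hk2⟩ := exists_prefixRatio_near hρ hρ1 w hrm (pow_pos hγ m)
      (pow_le_one₀ hγ.le hγ1.le)
    have hR := prefixRatio_pos hρ w k
    have hk3 : γ ^ (m + r) ≤ prefixRatio ρ w k :=
      (pow_le_pow_of_le_one hγ.le hγ1.le (Nat.le_add_right m r)).trans hk1
    refine ⟨_, h k m hk1, _, h k (m + r) hk3, ?_, ?_⟩
    · have : rm ≤ γ ^ m / prefixRatio ρ w k := by rwa [le_div_iff₀' hR]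
      exact mul_le_mul this (hca m) hc.le (hrm0.le.trans this)
    · have h1 := (hpos m).ne'
      have h2 := hγ.ne'
      have h3 := hR.ne'
      change γ ^ r * (a (m + r) / a m) = γ ^ (m + r) / prefixRatio ρ w k * a (m + r) /
        (γ ^ m / prefixRatio ρ w k * a m)
      field_simp
      ring
  set L := ‖M‖ / c + A * ‖M‖ / c ^ 2 with hL
  have hL0 : 0 ≤ L := by positivity
  have hquot : ∀ m n m' n', |a m / a n - a m' / a n'| ≤
      ‖M‖ / c * dist (q m) (q m') + A * ‖M‖ / c ^ 2 * dist (q n) (q n') := by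
    intro m n m' n'
    refine (abs_div_sub_div_le hc (hca n) (hca n') (haA m')).trans ?_
    calc |a m - a m'| / c + A * |a n - a n'| / c ^ 2
        ≤ (‖M‖ * dist (q m) (q m')) / c + A * (‖M‖ * dist (q n) (q n')) / c ^ 2 := by
          gcongr <;> exact haL _ _
      _ = _ := by ring
  have key : ∀ ε > 0, ∃ p : ℕ, 1 ≤ p ∧ ∀ j m : ℕ, |a (m + p * j) / a m - 1| ≤ ε := by
    intro ε hε
    obtain ⟨N, hN⟩ := hdense (ε / (8 * (L + 1))) (by positivity)
    set ε₁ := ε / 8 / (A / c) with hε₁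
    have hε₁0 : 0 < ε₁ := by positivity
    obtain ⟨η, hη, hchain⟩ := hXb.chain_le hs (ε := γ ^ N * ε₁) (by positivity)
    obtain ⟨p, hp, hpq⟩ := hrec (η / (L + 1)) (by positivity)
    refine ⟨p, hp, fun j m => ?_⟩
    have hr : ∀ r < N, ∀ m, |a (m + p * j + r) / a (m + p * j) - a (m + r) / a m| ≤ ε₁ := by
      intro r hr m
      have h1 := hchain (fun j => γ ^ r * (a (m + p * j + r) / a (m + p * j))) (fun j => hXm _ _)
        (fun j => by
          rw [← mul_sub, abs_mul, abs_of_pos (pow_pos hγ r)]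
          refine (mul_le_of_le_one_left (abs_nonneg _) (pow_le_one₀ hγ.le hγ1.le)).trans ?_
          refine (hquot _ _ _ _).trans ?_
          have e1 := hpq (m + p * j + r)
          have e2 := hpq (m + p * j)
          rw [show m + p * j + r + p = m + p * (j + 1) + r by ring] at e1
          rw [show m + p * j + p = m + p * (j + 1) by ring] at e2
          calc _ ≤ ‖M‖ / c * (η / (L + 1)) + A * ‖M‖ / c ^ 2 * (η / (L + 1)) := by gcongr
            _ = L / (L + 1) * η := by rw [hL]; ring
            _ ≤ 1 * η := by
              gcongr
              rw [div_le_one (by positivity)]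
              linarith
            _ = η := one_mul _) j
      rw [← mul_sub, abs_mul, abs_of_pos (pow_pos hγ r)] at h1
      have h2 : γ ^ N ≤ γ ^ r := pow_le_pow_of_le_one hγ.le hγ1.le hr.le
      have h3 : γ ^ r * |a (m + p * j + r) / a (m + p * j) - a (m + r) / a m| ≤ γ ^ r * ε₁ := by
        refine le_trans ?_ (mul_le_mul_of_nonneg_right h2 hε₁0.le)
        simpa using h1
      exact le_of_mul_le_mul_left h3 (pow_pos hγ r)
    have hconst : ∀ n, |a (n + p * j) / a n - a (0 + p * j) / a 0| ≤ ε / 4 := by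
      intro n
      obtain ⟨r, hrN, hdr⟩ := hN n
      have h1 := hr r hrN 0
      have h2 : |a (r + p * j) / a r - a (0 + p * j) / a 0| ≤ ε / 8 := by
        have e : a (r + p * j) / a r - a (0 + p * j) / a 0 =
            (a (0 + p * j + r) / a (0 + p * j) - a (0 + r) / a 0) * (a (0 + p * j) / a r) := by
          have h3 := (hpos r).ne'
          have h4 := (hpos 0).ne'
          have h5 := (hpos (0 + p * j)).ne'
          rw [zero_add r, show 0 + p * j + r = r + p * j by ring]
          field_simp
        rw [e, abs_mul, abs_of_pos (div_pos (hpos _) (hpos r))]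
        calc _ ≤ ε₁ * (A / c) := by
              gcongr
              · exact hA _
              · exact hca r
          _ = ε / 8 := by rw [hε₁]; field_simp
      have h3 := hquot (n + p * j) n (r + p * j) r
      rw [add_comm n, add_comm r, hqd] at h3
      have h4 : |a (p * j + n) / a n - a (p * j + r) / a r| ≤ ε / 8 := by
        calc _ ≤ L * dist (q n) (q r) := h3.trans_eq (by rw [hL]; ring)
          _ ≤ (L + 1) * (ε / (8 * (L + 1))) := by gcongr; linarith
          _ = ε / 8 := by field_simp
      rw [add_comm n]
      rw [add_comm r] at h2
      have := abs_sub_le (a (p * j + n) / a n) (a (p * j + r) / a r) (a (0 + p * j) / a 0)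
      linarith
    have := abs_ratio_sub_one_le hc hca hA (ε := ε / 2) (by positivity) (p * j) (fun n m => by
      have h1 := hconst n
      have h2 := hconst m
      rw [abs_sub_comm] at h2
      have := abs_sub_le (a (n + p * j) / a n) (a (0 + p * j) / a 0) (a (m + p * j) / a m)
      linarith) m
    linarith
  refine exists_period_of_almost_period M P v fun ε hε => ?_
  obtain ⟨p, hp, hpj⟩ := key (ε / (2 * A ^ 2)) (by positivity)
  refine ⟨p, hp, fun j m => ?_⟩
  change |a (m + p * j) ^ 2 - a m ^ 2| ≤ ε
  have e : a (m + p * j) ^ 2 - a m ^ 2 =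
      (a (m + p * j) / a m - 1) * (a m * (a (m + p * j) + a m)) := by
    have := (hpos m).ne'
    field_simp
    ring
  rw [e, abs_mul, abs_of_pos (mul_pos (hpos m) (add_pos (hpos _) (hpos m)))]
  calc _ ≤ ε / (2 * A ^ 2) * (A * (A + A)) := by
        gcongr
        · exact hpj j m
        · exact hA _
        · exact hA _
        · exact hA _
    _ = ε := by field_simp; ring

end Orbit

/-! ### Pigeonhole and windows of binary words -/

/-- Two of the points `x 0, …, x (N ^ d)` of the torus of dimension `d` agree up to `1 / N` in
every coordinate. -/
lemma exists_fract_close {d : ℕ} (x : ℕ → Fin d → ℝ) {N : ℕ} (hN : 0 < N) :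
    ∃ q₁ q₂ : ℕ, q₁ < q₂ ∧ q₂ ≤ N ^ d ∧
      ∀ j, |Int.fract (x q₂ j) - Int.fract (x q₁ j)| ≤ 1 / N := by
  have hN' : (0 : ℝ) < N := by exact_mod_cast hN
  have hlt : ∀ q j, ⌊N * Int.fract (x q j)⌋₊ < N := fun q j => by
    rw [Nat.floor_lt (mul_nonneg hN'.le (Int.fract_nonneg _))]
    exact mul_lt_of_lt_one_right hN' (Int.fract_lt_one _)
  obtain ⟨q₁, h₁, q₂, h₂, hne, heq⟩ := Finset.exists_ne_map_eq_of_card_lt_of_maps_to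
    (s := Finset.range (N ^ d + 1)) (t := (Finset.univ : Finset (Fin d → Fin N)))
    (f := fun q j => ⟨⌊N * Int.fract (x q j)⌋₊, hlt q j⟩) (by simp) (by simp)
  have hclose : ∀ j, |Int.fract (x q₂ j) - Int.fract (x q₁ j)| ≤ 1 / N := fun j => by
    have e : ⌊N * Int.fract (x q₁ j)⌋₊ = ⌊N * Int.fract (x q₂ j)⌋₊ := by
      simpa using congrFun heq j
    have a1 := Nat.floor_le (mul_nonneg hN'.le (Int.fract_nonneg (x q₁ j)))
    have a2 := Nat.lt_floor_add_one ((N : ℝ) * Int.fract (x q₁ j))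
    have b1 := Nat.floor_le (mul_nonneg hN'.le (Int.fract_nonneg (x q₂ j)))
    have b2 := Nat.lt_floor_add_one ((N : ℝ) * Int.fract (x q₂ j))
    rw [e] at a1 a2
    have h : |(N : ℝ) * (Int.fract (x q₂ j) - Int.fract (x q₁ j))| ≤ 1 := by
      rw [mul_sub, abs_le]
      constructor <;> linarith
    rw [abs_mul, Nat.abs_cast] at h
    rwa [le_div_iff₀ hN', mul_comm]
  simp only [Finset.mem_range] at h₁ h₂
  rcases lt_or_gt_of_ne hne with h | h
  · exact ⟨q₁, q₂, h, by omega, hclose⟩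
  · exact ⟨q₂, q₁, h, by omega, fun j => by rw [abs_sub_comm]; exact hclose j⟩

/-- Discrete intermediate value theorem. -/
lemma exists_eq_of_unit_steps {f : ℕ → ℤ} (hf : ∀ k, |f (k + 1) - f k| ≤ 1) {c : ℤ} {k₁ k₂ : ℕ}
    (h₁ : f k₁ ≤ c) (h₂ : c ≤ f k₂) : ∃ k, f k = c := by
  by_contra! hne
  have hsame : ∀ k, (f k < c ↔ f (k + 1) < c) := fun k => by
    have h1 := abs_le.1 (hf k)
    have h2 := hne k
    have h3 := hne (k + 1)
    omega
  have hall : ∀ k, (f k < c ↔ f 0 < c) := fun k => by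
    induction k with
    | zero => rfl
    | succ k ih => rw [← hsame, ih]
  have h1 := hall k₁
  have h2 := hall k₂
  have h3 := hne k₁
  omega

/-- Let `cnt` count the occurrences of a letter in the prefixes of a word. There is a density `θ`
such that for every `n ≥ 1` each integer closer than `1` to `n θ` is the count of the letter in
some window of length `n`. -/
lemma exists_density {cnt : ℕ → ℤ} (h0 : ∀ k, cnt k ≤ cnt (k + 1))
    (h1 : ∀ k, cnt (k + 1) ≤ cnt k + 1) : ∃ θ : ℝ, ∀ n : ℕ, 1 ≤ n → ∀ a : ℤ,
      |(a : ℝ) - n * θ| < 1 → ∃ k, cnt (k + n) - cnt k = a := by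
  have hblock : ∀ n m : ℕ, ∀ c : ℤ, (∀ k, cnt (k + n) - cnt k ≤ c) →
      cnt (m * n) - cnt 0 ≤ m * c := fun n m c hc => by
    induction m with
    | zero => simp
    | succ m ih =>
      have := hc (m * n)
      rw [Nat.succ_mul]
      push_cast
      linarith
  have hblock' : ∀ n m : ℕ, ∀ c : ℤ, (∀ k, c ≤ cnt (k + n) - cnt k) →
      m * c ≤ cnt (m * n) - cnt 0 := fun n m c hc => by
    induction m with
    | zero => simp
    | succ m ih =>
      have := hc (m * n)
      rw [Nat.succ_mul]
      push_cast
      linarith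
  set A : Set ℝ := {x | ∃ n : ℕ, 1 ≤ n ∧ ∃ b : ℤ, (∀ k, b ≤ cnt (k + n) - cnt k) ∧ x = b / n}
    with hA
  have hle : ∀ n : ℕ, 1 ≤ n → ∀ c : ℤ, (∀ k, cnt (k + n) - cnt k ≤ c) → ∀ x ∈ A, x ≤ c / n := by
    rintro n hn c hc x ⟨m, hm, b, hb, rfl⟩
    have e1 := hblock n m c hc
    have e2 := hblock' m n b hb
    rw [mul_comm n m] at e2
    have e3 : (n : ℤ) * b ≤ m * c := e2.trans e1
    rw [div_le_div_iff₀ (by exact_mod_cast hm) (by exact_mod_cast hn)]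
    have e4 : (n : ℝ) * b ≤ m * c := by exact_mod_cast e3
    linarith
  have hwin : ∀ n k, cnt (k + n) - cnt k ≤ n := fun n k => by
    induction n with
    | zero => simp
    | succ n ih =>
      have := h1 (k + n)
      rw [← add_assoc]
      push_cast
      linarith
  have hwin' : ∀ n k, 0 ≤ cnt (k + n) - cnt k := fun n k => by
    induction n with
    | zero => simp
    | succ n ih =>
      have := h0 (k + n)
      rw [← add_assoc]
      linarith
  have hbdd : BddAbove A := ⟨((1 : ℕ) : ℤ) / (1 : ℕ), hle 1 le_rfl _ (hwin 1)⟩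
  have hne : A.Nonempty := ⟨_, 1, le_rfl, 0, hwin' 1, rfl⟩
  refine ⟨sSup A, fun n hn a ha => ?_⟩
  have hn' : (0 : ℝ) < n := by exact_mod_cast hn
  have hup : ∃ k, a ≤ cnt (k + n) - cnt k := by
    by_contra! hcon
    have := csSup_le hne (hle n hn (a - 1) fun k => by have := hcon k; omega)
    rw [le_div_iff₀ hn'] at this
    push_cast at this
    linarith [(abs_lt.1 ha).2]
  have hlow : ∃ k, cnt (k + n) - cnt k ≤ a := by
    by_contra! hcon
    have := le_csSup hbdd (⟨n, hn, a + 1, fun k => by have := hcon k; omega, rfl⟩ :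
      (((a + 1 : ℤ) : ℝ) / n) ∈ A)
    rw [div_le_iff₀ hn'] at this
    push_cast at this
    linarith [(abs_lt.1 ha).1]
  obtain ⟨k₁, hk₁⟩ := hlow
  obtain ⟨k₂, hk₂⟩ := hup
  refine exists_eq_of_unit_steps (f := fun k => cnt (k + n) - cnt k) (fun k => ?_) hk₁ hk₂
  have e1 := h0 k
  have e2 := h1 k
  have e3 := h0 (k + n)
  have e4 := h1 (k + n)
  rw [show k + 1 + n = k + n + 1 by ring, abs_le]
  constructor <;> linarith

/-! ### Two rotations -/

/-- The sum of the numbers `α` along the first `k` letters of `w`. -/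
noncomputable def wordSum {ℓ : ℕ} (α : Fin ℓ → ℝ) (w : ℕ → Fin ℓ) (k : ℕ) : ℝ :=
  ∑ i ∈ Finset.range k, α (w i)

lemma HasBoxBound.sub {A : Set ℝ} {s : ℝ} (hA : HasBoxBound A s) :
    HasBoxBound {z : ℝ | ∃ x ∈ A, ∃ y ∈ A, z = x - y} (s + s) := by
  refine ((hA.prod hA).image (fun p => p.1 - p.2) 2 (by norm_num) fun p _ q _ => ?_).mono ?_
  · have h1 : |p.1 - q.1| ≤ dist p q := by rw [← Real.dist_eq]; exact le_max_left _ _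
    have h2 : |p.2 - q.2| ≤ dist p q := by rw [← Real.dist_eq]; exact le_max_right _ _
    rw [Real.dist_eq, show p.1 - p.2 - (q.1 - q.2) = (p.1 - q.1) - (p.2 - q.2) by ring]
    linarith [abs_sub (p.1 - q.1) (p.2 - q.2)]
  · rintro z ⟨x, hx, y, hy, rfl⟩
    exact ⟨(x, y), ⟨hx, hy⟩, rfl⟩

lemma one_le_abs_intCast {z : ℤ} (hz : z ≠ 0) : (1 : ℝ) ≤ |(z : ℝ)| := by
  exact_mod_cast Int.one_le_abs hz

/-- Let the set `Z` of covering exponent `σ` contain, modulo `1`, the numbers `n β + a κ` for all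
`n ≥ 1` and `|a - n θ| < 1`. An integer vector `(p, a, b)` whose multiples stay in this strip
gives an arithmetic progression in `Z`, so the form `τ = p β + a κ - b` cannot be nonzero and small
unless `π = p θ - a` is much larger. -/
lemma rpow_abs_le_of_strip {Z : Set ℝ} {σ : ℝ} (hZ : HasBoxBound Z σ) (hσ1 : σ < 1)
    {β κ θ : ℝ} (hmem : ∀ n : ℕ, 1 ≤ n → ∀ a : ℤ, |(a : ℝ) - n * θ| < 1 →
      ∃ z : ℤ, n * β + a * κ + z ∈ Z) :
    ∃ C : ℝ, 0 < C ∧ ∃ κ₀ : ℝ, 0 < κ₀ ∧ κ₀ ≤ 1 / 2 ∧ ∀ p a b : ℤ, |p * θ - a| ≤ κ₀ →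
      p * β + a * κ - b ≠ 0 → |p * β + a * κ - b| ≤ κ₀ →
      |p * β + a * κ - b| ^ σ ≤ C * |p * θ - a| := by
  obtain ⟨C, hC, hcard⟩ := hZ.card_le
  set C' := 4 * C * 2 ^ σ with hC'
  have hC'0 : 0 < C' := by positivity
  obtain ⟨η, hη, hη1, hsmall⟩ := exists_small_rpow (e := 1 - σ) (A := 1 / C') (by linarith)
    (by positivity)
  refine ⟨C', hC'0, min η (1 / 2), by positivity, min_le_right _ _, ?_⟩
  have key : ∀ p : ℕ, 1 ≤ p → ∀ a b : ℤ, |p * θ - a| ≤ min η (1 / 2) →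
      p * β + a * κ - b ≠ 0 → |p * β + a * κ - b| ≤ min η (1 / 2) →
      |p * β + a * κ - b| ^ σ ≤ C' * |p * θ - a| := by
    intro p hp a b hπ hτ0 hτ
    set π' := (p : ℝ) * θ - a with hπ'
    set τ := (p : ℝ) * β + a * κ - b with hτ'
    have hτpos : 0 < |τ| := abs_pos.2 hτ0
    set μ := max |π'| |τ| with hμ
    have hμ0 : 0 < μ := hτpos.trans_le (le_max_right _ _)
    have hμ1 : μ ≤ 1 / 2 := max_le (hπ.trans (min_le_right _ _)) (hτ.trans (min_le_right _ _))
    set J := ⌊1 / (2 * μ)⌋₊ with hJ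
    have hJle : J * μ ≤ 1 / 2 := by
      have := Nat.floor_le (a := 1 / (2 * μ)) (by positivity)
      rw [← hJ, le_div_iff₀ (by positivity)] at this
      linarith
    have hJge : 1 / (4 * μ) ≤ J := by
      have h1 : 1 / (2 * μ) < J + 1 := Nat.lt_floor_add_one _
      have h2 : (1 : ℝ) ≤ J := by
        have : 1 ≤ J := Nat.le_floor (by
          rw [Nat.cast_one, le_div_iff₀ (by positivity)]; linarith)
        exact_mod_cast this
      rw [div_le_iff₀ (by positivity)]
      rw [div_lt_iff₀ (by positivity)] at h1
      nlinarith
    have hJc : (J : ℝ) ≤ C * (|τ| / 2) ^ (-σ) := by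
      have hx : ∀ i < J, ∃ z : ℤ, ((i + 1 : ℕ) : ℝ) * τ + z ∈ Z := by
        intro i hi
        have hiJ : ((i + 1 : ℕ) : ℝ) ≤ J := by exact_mod_cast hi
        obtain ⟨z, hz⟩ := hmem ((i + 1) * p) (Nat.mul_pos (Nat.succ_pos i) hp)
          (((i + 1 : ℕ) : ℤ) * a) (by
            have e : (((((i + 1 : ℕ) : ℤ) * a : ℤ)) : ℝ) - (((i + 1) * p : ℕ) : ℝ) * θ =
                -(((i + 1 : ℕ) : ℝ) * π') := by rw [hπ']; push_cast; ring
            rw [e, abs_neg, abs_mul, Nat.abs_cast]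
            calc ((i + 1 : ℕ) : ℝ) * |π'| ≤ J * μ := by
                  gcongr
                  exact le_max_left _ _
              _ < 1 := by linarith)
        refine ⟨z + ((i + 1 : ℕ) : ℤ) * b, ?_⟩
        convert hz using 1
        rw [hτ']
        push_cast
        ring
      choose! z hz using hx
      refine hcard (|τ| / 2) (by positivity) (by linarith [hτ.trans (min_le_right _ _)]) J
        (fun i => ((i + 1 : ℕ) : ℝ) * τ + z i) hz fun i hi j hj hij => ?_
      have hij' : (i : ℝ) + 1 ≤ j := by exact_mod_cast hij
      have hjJ : (j : ℝ) + 1 ≤ J := by exact_mod_cast hj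
      have hi0 : (0 : ℝ) ≤ i := Nat.cast_nonneg i
      have e : ((i + 1 : ℕ) : ℝ) * τ + z i - (((j + 1 : ℕ) : ℝ) * τ + z j) =
          -(((j : ℝ) - i) * τ + ((z j - z i : ℤ) : ℝ)) := by push_cast; ring
      rw [Real.dist_eq, e, abs_neg]
      have hm : |((j : ℝ) - i) * τ| = (j - i) * |τ| := by
        rw [abs_mul, abs_of_pos (by linarith)]
      by_cases hz0 : z j - z i = 0
      · rw [hz0, Int.cast_zero, add_zero, hm]
        nlinarith
      · have h1 := one_le_abs_intCast hz0
        have h2 : ((j : ℝ) - i) * |τ| ≤ 1 / 2 := by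
          refine le_trans ?_ hJle
          gcongr
          · linarith
          · exact le_max_right _ _
        have h3 := abs_sub_abs_le_abs_sub ((z j - z i : ℤ) : ℝ) (-(((j : ℝ) - i) * τ))
        rw [abs_neg, hm, sub_neg_eq_add, add_comm ((z j - z i : ℤ) : ℝ)] at h3
        linarith [hτ.trans (min_le_right _ _)]
    have hmain : |τ| ^ σ ≤ C' * μ := by
      have h1 := hJge.trans hJc
      rw [Real.rpow_neg (by positivity), Real.div_rpow hτpos.le (by norm_num), inv_div] at h1
      have h2 : (0 : ℝ) < |τ| ^ σ := by positivity
      rw [← mul_div_assoc, div_le_div_iff₀ (by positivity) h2] at h1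
      rw [hC']
      linarith
    rcases le_total |τ| |π'| with h | h
    · rwa [hμ, max_eq_left h] at hmain
    · exfalso
      rw [hμ, max_eq_right h] at hmain
      have h1 := hsmall |τ| hτpos (hτ.trans (min_le_left _ _))
      rw [Real.rpow_sub hτpos, Real.rpow_one, div_lt_div_iff₀ (by positivity) hC'0] at h1
      linarith
  intro p a b hπ hτ0 hτ
  rcases lt_trichotomy p 0 with hp | hp | hp
  · obtain ⟨m, hm⟩ := Int.eq_ofNat_of_zero_le (show 0 ≤ -p by omega)
    have hpm : (p : ℝ) = -(m : ℝ) := by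
      have : p = -(m : ℤ) := by omega
      rw [this]; push_cast; ring
    have e1 : (p : ℝ) * θ - a = -((m : ℝ) * θ - ((-a : ℤ) : ℝ)) := by rw [hpm]; push_cast; ring
    have e2 : (p : ℝ) * β + a * κ - b = -((m : ℝ) * β + ((-a : ℤ) : ℝ) * κ - ((-b : ℤ) : ℝ)) := by
      rw [hpm]; push_cast; ring
    rw [e1, abs_neg] at hπ ⊢
    rw [e2, abs_neg] at hτ ⊢
    rw [e2, neg_ne_zero] at hτ0
    exact key m (by omega) _ _ hπ hτ0 hτ
  · exfalso
    subst hp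
    simp only [Int.cast_zero, zero_mul, zero_sub, zero_add, abs_neg] at hπ hτ0 hτ
    have ha : a = 0 := by
      by_contra ha
      linarith [one_le_abs_intCast ha, hπ.trans (min_le_right _ _)]
    rw [ha, Int.cast_zero, zero_mul, zero_sub, abs_neg] at hτ
    have hb : b ≠ 0 := by rintro rfl; simp [ha] at hτ0
    linarith [one_le_abs_intCast hb, hτ.trans (min_le_right _ _)]
  · obtain ⟨m, rfl⟩ := Int.eq_ofNat_of_zero_le hp.le
    have := key m (by omega) a b
    simp only [Int.cast_natCast] at hπ hτ0 hτ ⊢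
    exact this hπ hτ0 hτ

/-- If the orbit of a point under two rotations of the circle, applied in any order, has covering
exponent less than `1 / 2`, then the rotation angles satisfy a nonnegative integer relation. -/
lemma exists_relation_of_two_rotations {α : Fin 2 → ℝ} {w : ℕ → Fin 2} {s : ℝ} (hs0 : 0 ≤ s)
    (hs : s + s < 1) (hbox : HasBoxBound (Set.range fun k => Int.fract (-wordSum α w k)) s) :
    ∃ n : Fin 2 → ℕ, n ≠ 0 ∧ ∃ r : ℚ, ∑ i, (n i : ℝ) * α i = r := by
  by_contra! hno
  set β := α 1 with hβ
  set κ := α 0 - α 1 with hκ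
  set cnt : ℕ → ℤ := fun k => ∑ i ∈ Finset.range k, if w i = 0 then 1 else 0 with hcnt
  have hstep : ∀ k, cnt (k + 1) = cnt k + if w k = 0 then 1 else 0 := fun k =>
    Finset.sum_range_succ _ _
  have hc0 : ∀ k, cnt k ≤ cnt (k + 1) := fun k => by rw [hstep]; split_ifs <;> omega
  have hc1 : ∀ k, cnt (k + 1) ≤ cnt k + 1 := fun k => by rw [hstep]; split_ifs <;> omega
  have hcn : ∀ n k, 0 ≤ cnt (k + n) - cnt k ∧ cnt (k + n) - cnt k ≤ n := fun n k => by
    induction n with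
    | zero => simp
    | succ n ih =>
      have := hc0 (k + n)
      have := hc1 (k + n)
      rw [← add_assoc]
      push_cast
      omega
  have hS : ∀ k, wordSum α w k = k * β + cnt k * κ := fun k => by
    induction k with
    | zero => simp [wordSum, hcnt]
    | succ k ih =>
      rw [hstep, wordSum, Finset.sum_range_succ, ← wordSum, ih]
      have hw : α (w k) = β + ((if w k = 0 then 1 else 0 : ℤ) : ℝ) * κ := by
        rcases Fin.exists_fin_two.1 ⟨w k, rfl⟩ with h | h <;> simp [h, hβ, hκ]
      rw [hw]
      push_cast
      ring
  obtain ⟨θ, hθ⟩ := exists_density hc0 hc1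
  obtain ⟨C, hC, κ₀, hκ0, hκ1, hstrip⟩ := rpow_abs_le_of_strip hbox.sub hs (β := β) (κ := κ)
    (θ := θ) (fun n hn a ha => by
      obtain ⟨k, hk⟩ := hθ n hn a ha
      refine ⟨⌊-wordSum α w (k + n)⌋ - ⌊-wordSum α w k⌋, _, ⟨k, rfl⟩, _, ⟨k + n, rfl⟩, ?_⟩
      simp only [Int.fract, hS, ← hk]
      push_cast
      ring)
  have hnz : ∀ p : ℕ, 1 ≤ p → ∀ a b : ℤ, |p * θ - a| < 1 → (p : ℝ) * β + a * κ - b ≠ 0 := by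
    intro p hp a b hpa hzero
    obtain ⟨k, hk⟩ := hθ p hp a (by rwa [abs_sub_comm])
    obtain ⟨h1, h2⟩ := hcn p k
    rw [hk] at h1 h2
    lift a to ℕ using h1
    have h2' : a ≤ p := by exact_mod_cast h2
    refine hno ![a, p - a] ?_ b ?_
    · intro h
      have e0 := congrFun h 0
      have e1 := congrFun h 1
      simp at e0 e1
      omega
    · rw [Fin.sum_univ_two]
      simp only [Matrix.cons_val_zero, Matrix.cons_val_one, Nat.cast_sub h2', Rat.cast_intCast]
      rw [hβ, hκ] at hzero
      push_cast at hzero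
      linarith
  have hsmall : ∀ η > 0, ∃ p : ℕ, 1 ≤ p ∧ ∃ a b : ℤ, |p * θ - a| ≤ η ∧
      |p * β + a * κ - b| ≤ η := by
    intro η hη
    obtain ⟨N, hN⟩ := exists_nat_gt (1 / η)
    have hN0 : 0 < (N : ℝ) := lt_trans (by positivity) hN
    obtain ⟨q₁, q₂, hq, -, hclose⟩ := exists_fract_close
      (fun q => ![(q : ℝ) * θ, q * β + ⌊(q : ℝ) * θ⌋ * κ]) (N := N) (by exact_mod_cast hN0)
    have hNη : 1 / (N : ℝ) ≤ η := by
      rw [div_le_iff₀ hN0]; rw [div_lt_iff₀ hη] at hN; linarith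
    refine ⟨q₂ - q₁, by omega, ⌊(q₂ : ℝ) * θ⌋ - ⌊(q₁ : ℝ) * θ⌋,
      ⌊q₂ * β + ⌊(q₂ : ℝ) * θ⌋ * κ⌋ - ⌊q₁ * β + ⌊(q₁ : ℝ) * θ⌋ * κ⌋, ?_, ?_⟩
    · have := (hclose 0).trans hNη
      simp only [Matrix.cons_val_zero, Int.fract] at this
      refine le_of_eq_of_le (congrArg _ ?_) this
      rw [Nat.cast_sub hq.le]
      push_cast
      ring
    · have := (hclose 1).trans hNη
      simp only [Matrix.cons_val_one, Int.fract] at this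
      refine le_of_eq_of_le (congrArg _ ?_) this
      rw [Nat.cast_sub hq.le]
      push_cast
      ring
  obtain ⟨p₀, hp₀, a₀, b₀, hπ₀, hτ₀⟩ := hsmall (κ₀ / 2) (by positivity)
  have hτ₀0 := hnz p₀ hp₀ a₀ b₀ (by linarith)
  set π₀ := (p₀ : ℝ) * θ - a₀ with hπ₀'
  set τ₀ := (p₀ : ℝ) * β + a₀ * κ - b₀ with hτ₀'
  have hτ₀pos : 0 < |τ₀| := abs_pos.2 hτ₀0
  obtain ⟨η₁, hη₁, -, hη₁s⟩ := exists_small_rpow (e := 1 - (s + s)) (A := |τ₀| / (2 * C))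
    (by linarith) (by positivity)
  set A := (|τ₀| / 2) ^ (s + s) with hA
  have hA0 : 0 < A := by positivity
  obtain ⟨p, hp, a, b, hπ, hτ⟩ := hsmall (min (min η₁ (κ₀ / 2)) (A / (2 * C))) (by positivity)
  have hτ0 := hnz p hp a b (by
    linarith [hπ.trans ((min_le_left _ _).trans (min_le_right _ _))])
  have hg := hstrip p a b
  rw [Int.cast_natCast] at hg
  set π₁ := (p : ℝ) * θ - a with hπ₁'
  set τ₁ := (p : ℝ) * β + a * κ - b with hτ₁'
  have hπκ : |π₁| ≤ κ₀ / 2 := hπ.trans ((min_le_left _ _).trans (min_le_right _ _))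
  have hτκ : |τ₁| ≤ κ₀ / 2 := hτ.trans ((min_le_left _ _).trans (min_le_right _ _))
  have hτη : |τ₁| ≤ η₁ := hτ.trans ((min_le_left _ _).trans (min_le_left _ _))
  have hτ1pos : 0 < |τ₁| := abs_pos.2 hτ0
  replace hg := hg (by linarith) hτ0 (by linarith)
  have hπ1pos : 0 < |π₁| := by
    by_contra! h
    have h1 : 0 < |τ₁| ^ (s + s) := by positivity
    nlinarith
  -- subtract a multiple of the tiny vector to bring the fixed one close to the line of slope `θ`
  set j := ⌊π₀ / π₁⌋ with hj
  have hjfr : |π₀ - j * π₁| ≤ |π₁| := by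
    have hne : π₁ ≠ 0 := abs_pos.1 hπ1pos
    have e : π₀ - j * π₁ = Int.fract (π₀ / π₁) * π₁ := by
      rw [Int.fract, sub_mul, div_mul_cancel₀ _ hne]
    rw [e, abs_mul, abs_of_nonneg (Int.fract_nonneg _)]
    exact mul_le_of_le_one_left (abs_nonneg _) (Int.fract_lt_one _).le
  have hjπ : |(j : ℝ)| * |π₁| ≤ 1 := by
    rw [← abs_mul]
    have := abs_sub_abs_le_abs_sub ((j : ℝ) * π₁) π₀
    rw [abs_sub_comm _ π₀] at this
    linarith
  have hjτ : |(j : ℝ) * τ₁| < |τ₀| / 2 := by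
    have h1 := hη₁s |τ₁| hτ1pos hτη
    rw [Real.rpow_sub hτ1pos, Real.rpow_one] at h1
    have h2 : 0 < |τ₁| ^ (s + s) := by positivity
    rw [div_lt_div_iff₀ h2 (by positivity)] at h1
    have h3 : |(j : ℝ)| * |τ₁| ^ (s + s) ≤ C := by
      calc _ ≤ |(j : ℝ)| * (C * |π₁|) := by gcongr
        _ = C * (|(j : ℝ)| * |π₁|) := by ring
        _ ≤ C * 1 := by gcongr
        _ = C := mul_one C
    rw [abs_mul]
    rcases (abs_nonneg (j : ℝ)).eq_or_lt with h0 | h0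
    · rw [← h0, zero_mul]; positivity
    · have h5 : |(j : ℝ)| * |τ₁| * (2 * C) < |τ₀| * C := by
        calc |(j : ℝ)| * |τ₁| * (2 * C) = |(j : ℝ)| * (|τ₁| * (2 * C)) := by ring
          _ < |(j : ℝ)| * (|τ₀| * |τ₁| ^ (s + s)) := by gcongr
          _ = |τ₀| * (|(j : ℝ)| * |τ₁| ^ (s + s)) := by ring
          _ ≤ |τ₀| * C := by gcongr
      nlinarith
  have hv := hstrip (p₀ - j * p) (a₀ - j * a) (b₀ - j * b)
  have e1 : (((p₀ - j * p : ℤ) : ℝ)) * θ - ((a₀ - j * a : ℤ) : ℝ) = π₀ - j * π₁ := by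
    rw [hπ₀', hπ₁']; push_cast; ring
  have e2 : (((p₀ - j * p : ℤ) : ℝ)) * β + ((a₀ - j * a : ℤ) : ℝ) * κ - ((b₀ - j * b : ℤ) : ℝ) =
      τ₀ - j * τ₁ := by
    rw [hτ₀', hτ₁']; push_cast; ring
  rw [e1, e2] at hv
  have hlow : |τ₀| / 2 ≤ |τ₀ - j * τ₁| := by
    have := abs_sub_abs_le_abs_sub τ₀ (j * τ₁)
    linarith
  have hupp : |τ₀ - j * τ₁| ≤ κ₀ := by
    have := abs_sub τ₀ (j * τ₁)
    linarith
  have hfin := hv (by linarith) (abs_pos.1 (lt_of_lt_of_le (by positivity) hlow)) hupp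
  have h1 : A ≤ |τ₀ - j * τ₁| ^ (s + s) := Real.rpow_le_rpow (by positivity) hlow (by linarith)
  have h2 : C * |π₀ - j * π₁| ≤ C * (A / (2 * C)) := by
    gcongr
    exact hjfr.trans (hπ.trans (min_le_right _ _))
  have h3 : C * (A / (2 * C)) = A / 2 := by field_simp
  linarith

/-! ### Several rotations -/

/-- Real numbers are integer combinations of as many reals as the rank of their `ℚ`-span. -/
lemma exists_integer_coordinates {ℓ : ℕ} (x : Fin ℓ → ℝ) :
    ∃ (ξ : Fin (Module.finrank ℚ (Submodule.span ℚ (Set.range x))) → ℝ)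
      (c : Fin ℓ → Fin (Module.finrank ℚ (Submodule.span ℚ (Set.range x))) → ℤ),
      ∀ i, x i = ∑ j, (c i j : ℝ) * ξ j := by
  set U := Submodule.span ℚ (Set.range x)
  have : FiniteDimensional ℚ U := FiniteDimensional.span_of_finite ℚ (Set.finite_range x)
  let b := Module.finBasis ℚ U
  let y : Fin ℓ → U := fun i => ⟨x i, Submodule.subset_span ⟨i, rfl⟩⟩
  let D : ℕ := ∏ p : Fin ℓ × Fin (Module.finrank ℚ U), (b.repr (y p.1) p.2).den
  have hD : (D : ℝ) ≠ 0 := by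
    have : D ≠ 0 := Finset.prod_ne_zero_iff.2 fun p _ => Rat.den_nz _
    exact_mod_cast this
  have hint : ∀ i j, ∃ z : ℤ, ((b.repr (y i) j : ℚ) : ℝ) * D = z := fun i j => by
    obtain ⟨e, he⟩ : (b.repr (y i) j).den ∣ D :=
      Finset.dvd_prod_of_mem (fun p : Fin ℓ × Fin (Module.finrank ℚ U) =>
        (b.repr (y p.1) p.2).den) (Finset.mem_univ (i, j))
    refine ⟨(b.repr (y i) j).num * e, ?_⟩
    have h1 : (((b.repr (y i) j).den : ℕ) : ℝ) ≠ 0 := by exact_mod_cast (b.repr (y i) j).den_nz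
    rw [he]
    conv_lhs => rw [Rat.cast_def]
    push_cast
    field_simp
  choose c hc using hint
  refine ⟨fun j => (b j : ℝ) / D, c, fun i => ?_⟩
  have h1 : x i = ∑ j, ((b.repr (y i) j : ℚ) : ℝ) * (b j : ℝ) := by
    have h2 := congrArg (U.subtype) (b.sum_repr (y i))
    rw [map_sum] at h2
    rw [show x i = U.subtype (y i) from rfl, ← h2]
    refine Finset.sum_congr rfl fun j _ => ?_
    rw [map_smul, Submodule.subtype_apply, Rat.smul_def]
  rw [h1]
  refine Finset.sum_congr rfl fun j _ => ?_
  rw [← hc]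
  field_simp

/-- Simultaneous rational approximation of integer combinations of `lam` reals. -/
lemma exists_simultaneous_approximation {ℓ lam : ℕ} (ξ : Fin lam → ℝ) (c : Fin ℓ → Fin lam → ℤ) :
    ∃ C : ℝ, 1 ≤ C ∧ ∀ N : ℕ, 0 < N → ∃ q : ℕ, 1 ≤ q ∧ q ≤ N ^ lam ∧ ∃ P : Fin ℓ → ℤ,
      ∀ i, |∑ j, (c i j : ℝ) * ξ j - P i / q| ≤ C / (q * N) := by
  refine ⟨1 + ∑ i, ∑ j, |(c i j : ℝ)|, le_add_of_nonneg_right (by positivity), fun N hN => ?_⟩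
  obtain ⟨q₁, q₂, hlt, hle, hclose⟩ := exists_fract_close (fun q j => (q : ℝ) * ξ j) hN
  have hN' : (0 : ℝ) < N := by exact_mod_cast hN
  refine ⟨q₂ - q₁, by omega, by omega,
    fun i => ∑ j, c i j * (⌊(q₂ : ℝ) * ξ j⌋ - ⌊(q₁ : ℝ) * ξ j⌋), fun i => ?_⟩
  have hq : (0 : ℝ) < ((q₂ - q₁ : ℕ) : ℝ) := by exact_mod_cast Nat.sub_pos_of_lt hlt
  have e : ∑ j, (c i j : ℝ) * ξ j -
      ((∑ j, c i j * (⌊(q₂ : ℝ) * ξ j⌋ - ⌊(q₁ : ℝ) * ξ j⌋) : ℤ) : ℝ) / ((q₂ - q₁ : ℕ) : ℝ) =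
      (∑ j, (c i j : ℝ) * (Int.fract ((q₂ : ℝ) * ξ j) - Int.fract ((q₁ : ℝ) * ξ j))) /
        ((q₂ - q₁ : ℕ) : ℝ) := by
    rw [eq_div_iff hq.ne', sub_mul, div_mul_cancel₀ _ hq.ne', Finset.sum_mul]
    push_cast
    rw [← Finset.sum_sub_distrib]
    refine Finset.sum_congr rfl fun j _ => ?_
    rw [Nat.cast_sub hlt.le, Int.fract, Int.fract]
    ring
  rw [e, abs_div, abs_of_pos hq, mul_comm, ← div_div]
  gcongr
  calc |∑ j, (c i j : ℝ) * (Int.fract ((q₂ : ℝ) * ξ j) - Int.fract ((q₁ : ℝ) * ξ j))|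
      ≤ ∑ j, |(c i j : ℝ)| * (1 / N) := by
        refine (Finset.abs_sum_le_sum_abs _ _).trans (Finset.sum_le_sum fun j _ => ?_)
        rw [abs_mul]
        gcongr
        exact hclose j
    _ = (∑ j, |(c i j : ℝ)|) * (1 / N) := by rw [Finset.sum_mul]
    _ ≤ (1 + ∑ i, ∑ j, |(c i j : ℝ)|) * (1 / N) := by
        gcongr
        have := Finset.single_le_sum (f := fun i => ∑ j, |(c i j : ℝ)|)
          (fun i _ => Finset.sum_nonneg fun j _ => abs_nonneg _) (Finset.mem_univ i)
        linarith
    _ = _ := by ring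

/-- Let the angles `α` be approximated by rationals `P / q` with error `η`. The orbit consists of
the rational points `∑ P / q` moved by the accumulated error. As long as this error is below
`1 / (4 q)` it separates points that have the same rational part, so an orbit with few separated
points cannot accumulate an error of `1 / (4 q)`. -/
lemma drift_le_of_card_le {ℓ : ℕ} {α : Fin ℓ → ℝ} {w : ℕ → Fin ℓ} {q : ℕ} (hq : 1 ≤ q)
    {P : Fin ℓ → ℤ} {η : ℝ} (hη : 0 < η) (hηq : η ≤ 1 / (4 * q))
    (hP : ∀ i, |α i - P i / q| ≤ η)
    (hcard : ∀ (n : ℕ) (x : ℕ → ℝ), (∀ i < n, x i ∈ Set.range fun k => Int.fract (-wordSum α w k)) →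
      (∀ i < n, ∀ j < n, i < j → η < dist (x i) (x j)) → (n : ℝ) < 1 / (12 * q * η)) (k : ℕ) :
    |wordSum (fun i => α i - P i / q) w k| ≤ 1 / (4 * q) := by
  have hq' : (0 : ℝ) < q := by exact_mod_cast hq
  set d := wordSum (fun i => α i - P i / q) w with hd
  by_contra! hk
  obtain ⟨σ, hσ, hσk⟩ : ∃ σ : ℝ, |σ| = 1 ∧ 1 / (4 * q) < σ * d k := by
    rcases le_total 0 (d k) with h0 | h0
    · exact ⟨1, by simp, by rwa [one_mul, ← abs_of_nonneg h0]⟩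
    · exact ⟨-1, by simp, by rwa [neg_one_mul, ← abs_of_nonpos h0]⟩
  set J := ⌊1 / (12 * q * η)⌋₊ with hJ
  have hJ1 : 3 * η * J ≤ 1 / (4 * q) := by
    have := Nat.floor_le (a := 1 / (12 * q * η)) (by positivity)
    rw [← hJ, le_div_iff₀ (by positivity)] at this
    rw [le_div_iff₀ (by positivity)]
    linarith
  have hpick := exists_index_near_of_small_steps (u := fun k => σ * d k) (η := η)
    (by simp [hd, wordSum]) hη (fun k => by
      have h1 : |σ * (α (w k) - P (w k) / q)| ≤ η := by rw [abs_mul, hσ, one_mul]; exact hP _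
      have h2 : d (k + 1) = d k + (α (w k) - P (w k) / q) := Finset.sum_range_succ _ _
      rw [h2]
      have := (abs_le.1 h1).2
      linarith) (K := k) (J := J) (hJ1.trans hσk.le)
  choose! κ _ hκ2 hκ3 using hpick
  -- the orbit is a rational translate of the accumulated error
  have horb : ∀ k, ∃ z : ℤ, Int.fract (-wordSum α w k) = -d k + z / q := fun k => by
    refine ⟨-∑ i ∈ Finset.range k, P (w i) - ⌊-wordSum α w k⌋ * q, ?_⟩
    rw [Int.fract, hd]
    simp only [wordSum, Finset.sum_sub_distrib]
    push_cast
    rw [← Finset.sum_div]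
    field_simp
    ring
  choose z hz using horb
  have hlt := hcard (J + 1) (fun i => Int.fract (-wordSum α w (κ i))) (fun i _ => ⟨_, rfl⟩) (by
    intro i hi j hj hij
    have a1 := hκ2 i (by omega)
    have a2 := hκ3 i (by omega)
    have a3 := hκ2 j (by omega)
    have a4 := hκ3 j (by omega)
    have hij' : (i : ℝ) + 1 ≤ j := by exact_mod_cast hij
    have hjJ : (j : ℝ) ≤ J := by exact_mod_cast Nat.lt_succ_iff.1 hj
    have hi0 : (0 : ℝ) ≤ i := Nat.cast_nonneg i
    have b1 : η < σ * (d (κ j) - d (κ i)) := by nlinarith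
    have b2 : σ * (d (κ j) - d (κ i)) ≤ 1 / (2 * q) := by
      have : 3 * η * j ≤ 3 * η * J := by gcongr
      have h0 : 0 ≤ 3 * η * i := by positivity
      have h1 : (1 : ℝ) / (2 * q) = 1 / (4 * q) + 1 / (4 * q) := by field_simp; norm_num
      rw [h1]
      linarith
    have b3 : |d (κ j) - d (κ i)| = σ * (d (κ j) - d (κ i)) := by
      rw [← abs_of_pos (hη.trans b1), abs_mul, hσ, one_mul]
    have e : Int.fract (-wordSum α w (κ i)) - Int.fract (-wordSum α w (κ j)) =
        (d (κ j) - d (κ i)) + ((z (κ i) - z (κ j) : ℤ) : ℝ) / q := by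
      rw [hz, hz]; push_cast; ring
    rw [Real.dist_eq, e]
    by_cases h0 : z (κ i) - z (κ j) = 0
    · rw [h0, Int.cast_zero, zero_div, add_zero, b3]
      exact b1
    · have c1 : 1 / (q : ℝ) ≤ |((z (κ i) - z (κ j) : ℤ) : ℝ) / q| := by
        rw [abs_div, Nat.abs_cast]
        gcongr
        exact one_le_abs_intCast h0
      have c2 := abs_sub_abs_le_abs_sub (((z (κ i) - z (κ j) : ℤ) : ℝ) / q)
        (-(d (κ j) - d (κ i)))
      rw [abs_neg, b3, sub_neg_eq_add, add_comm (((z (κ i) - z (κ j) : ℤ) : ℝ) / q)] at c2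
      have c3 : (1 : ℝ) / q = 1 / (2 * q) + 1 / (4 * q) + 1 / (4 * q) := by field_simp; norm_num
      have c4 : (0 : ℝ) < 1 / (4 * q) := by positivity
      linarith)
  have := Nat.lt_floor_add_one (1 / (12 * (q : ℝ) * η))
  push_cast at hlt
  linarith

/-- If arbitrarily good rational approximations `P / q` of `α` accumulate only a bounded error along
the word `w`, then some nonnegative integer combination of the `α i` is rational. The approximations
span, up to translation by one of them, a real subspace with a finite rational basis, on which two
prefixes of `w` agree by pigeonhole; being closed, this subspace contains the translate of `α`. -/
lemma exists_relation_of_bounded_drift {ℓ : ℕ} {α : Fin ℓ → ℝ} {w : ℕ → Fin ℓ}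
    (h : ∀ ε > 0, ∃ q : ℕ, 1 ≤ q ∧ ∃ P : Fin ℓ → ℤ, (∀ i, |α i - P i / q| ≤ ε) ∧
      ∀ k, |wordSum (fun i => α i - P i / q) w k| ≤ 1) :
    ∃ n : Fin ℓ → ℕ, n ≠ 0 ∧ ∃ r : ℚ, ∑ i, (n i : ℝ) * α i = r := by
  choose q hq P hP hdrift using fun n : ℕ => h (1 / ((n : ℝ) + 1)) (by positivity)
  have hq' : ∀ n, (0 : ℝ) < q n := fun n => by exact_mod_cast hq n
  let r : ℕ → Fin ℓ → ℝ := fun n i => P n i / q n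
  have hlim : Filter.Tendsto (fun n => r n - r 0) Filter.atTop (nhds (α - r 0)) := by
    refine Filter.Tendsto.sub_const ?_ _
    rw [tendsto_pi_nhds]
    intro i
    rw [tendsto_iff_dist_tendsto_zero]
    refine squeeze_zero (fun n => dist_nonneg) (fun n => ?_)
      (tendsto_one_div_add_atTop_nhds_zero_nat (𝕜 := ℝ))
    rw [dist_comm, Real.dist_eq]
    exact hP n i
  set W := Submodule.span ℝ (Set.range fun n => r n - r 0) with hW
  have hαW : α - r 0 ∈ W := (Submodule.closed_of_finiteDimensional W).mem_of_tendsto hlim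
    (Filter.Eventually.of_forall fun n => Submodule.subset_span ⟨n, rfl⟩)
  obtain ⟨T, hT, hTW⟩ := (Submodule.fg_span_iff_fg_span_finset_subset _).1
    (IsNoetherian.noetherian W)
  -- the sums of a generator along prefixes are rationals of bounded height
  have hgen : ∀ g : T, ∃ (e : ℕ) (z : ℕ → ℤ), 1 ≤ e ∧ ∀ k, (e : ℝ) * wordSum g.1 w k = z k ∧
      z k ∈ Set.Icc (-(2 * e : ℤ)) (2 * e) := by
    rintro ⟨g, hg⟩
    obtain ⟨n, rfl⟩ := hT hg
    refine ⟨q n * q 0, fun k => ∑ i ∈ Finset.range k, (P n (w i) * q 0 - P 0 (w i) * q n),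
      Nat.mul_pos (hq n) (hq 0), fun k => ?_⟩
    have e1 : ((q n * q 0 : ℕ) : ℝ) * wordSum (r n - r 0) w k =
        ((∑ i ∈ Finset.range k, (P n (w i) * q 0 - P 0 (w i) * q n) : ℤ) : ℝ) := by
      rw [wordSum, Finset.mul_sum]
      push_cast
      refine Finset.sum_congr rfl fun i _ => ?_
      have h1 := (hq' n).ne'
      have h2 := (hq' 0).ne'
      simp only [r, Pi.sub_apply]
      field_simp
    have e2 : |wordSum (r n - r 0) w k| ≤ 2 := by
      have : wordSum (r n - r 0) w k = wordSum (fun i => α i - P 0 i / q 0) w k -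
          wordSum (fun i => α i - P n i / q n) w k := by
        simp only [wordSum]
        rw [← Finset.sum_sub_distrib]
        refine Finset.sum_congr rfl fun i _ => ?_
        simp only [r, Pi.sub_apply]
        ring
      rw [this]
      refine (abs_sub _ _).trans ?_
      linarith [hdrift n k, hdrift 0 k]
    refine ⟨e1, ?_⟩
    have e3 : |((∑ i ∈ Finset.range k, (P n (w i) * q 0 - P 0 (w i) * q n) : ℤ) : ℝ)| ≤
        2 * ((q n * q 0 : ℕ) : ℝ) := by
      rw [← e1, abs_mul, Nat.abs_cast, mul_comm]
      gcongr
    rw [Set.mem_Icc, ← abs_le]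
    exact_mod_cast e3
  choose e z he hz using hgen
  have hfinite : ∀ g : T, Finite (Set.Icc (-(2 * e g : ℤ)) (2 * e g)) := fun g =>
    (Set.finite_Icc _ _).to_subtype
  obtain ⟨k₁, k₂, hne, heq⟩ := Finite.exists_ne_map_eq_of_infinite
    (fun k : ℕ => fun g : T => (⟨z g k, (hz g k).2⟩ : Set.Icc (-(2 * e g : ℤ)) (2 * e g)))
  have hsame : ∀ g : T, wordSum g.1 w k₁ = wordSum g.1 w k₂ := fun g => by
    have h1 : z g k₁ = z g k₂ := congrArg Subtype.val (congrFun heq g)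
    have h2 : (e g : ℝ) ≠ 0 := by exact_mod_cast (Nat.one_le_iff_ne_zero.1 (he g))
    have h3 := (hz g k₁).1
    rw [h1, ← (hz g k₂).1] at h3
    exact mul_left_cancel₀ h2 h3
  have main : ∀ a b : ℕ, a < b → (∀ g : T, wordSum g.1 w a = wordSum g.1 w b) →
      ∃ n : Fin ℓ → ℕ, n ≠ 0 ∧ ∃ r : ℚ, ∑ i, (n i : ℝ) * α i = r := by
    intro a b hab hsum
    have hfib : ∀ x : Fin ℓ → ℝ, ∑ i, (((Finset.Ico a b).filter fun j => w j = i).card : ℝ) * x i =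
        wordSum x w b - wordSum x w a := fun x => by
      rw [wordSum, wordSum, ← Finset.sum_Ico_eq_sub _ hab.le,
        ← Finset.sum_fiberwise (Finset.Ico a b) w fun j => x (w j)]
      refine Finset.sum_congr rfl fun i _ => ?_
      rw [Finset.sum_congr rfl (g := fun _ => x i) fun j hj => by rw [(Finset.mem_filter.1 hj).2],
        Finset.sum_const, nsmul_eq_mul]
    refine ⟨fun i => ((Finset.Ico a b).filter fun j => w j = i).card, fun h0 => ?_, ?_⟩
    · have h1 := congrFun h0 (w a)
      simp only [Pi.zero_apply, Finset.card_eq_zero] at h1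
      have h2 : a ∈ (Finset.Ico a b).filter fun j => w j = w a := by simp [hab]
      rw [h1] at h2
      exact absurd h2 (Finset.notMem_empty _)
    · let Λ : (Fin ℓ → ℝ) →ₗ[ℝ] ℝ :=
        ∑ i, (((Finset.Ico a b).filter fun j => w j = i).card : ℝ) • LinearMap.proj i
      have hΛ : ∀ x, Λ x = ∑ i, (((Finset.Ico a b).filter fun j => w j = i).card : ℝ) * x i :=
        fun x => by simp [Λ]
      have hker : W ≤ LinearMap.ker Λ := by
        rw [hW, hTW, Submodule.span_le]
        intro g hg
        rw [SetLike.mem_coe, LinearMap.mem_ker, hΛ, hfib, hsum ⟨g, hg⟩, sub_self]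
      have hα := hker hαW
      rw [LinearMap.mem_ker, map_sub, sub_eq_zero, hΛ, hΛ] at hα
      refine ⟨∑ i, (((Finset.Ico a b).filter fun j => w j = i).card : ℚ) * (P 0 i / q 0), ?_⟩
      rw [hα]
      push_cast
      rfl
  rcases lt_or_gt_of_ne hne with hlt | hlt
  · exact main k₁ k₂ hlt hsame
  · exact main k₂ k₁ hlt fun g => (hsame g).symm

/-- If the orbit of a point under rotations of the circle by the angles `α i`, which span a rational
space of dimension at most `lam`, applied in any order, has covering exponent less than
`1 / (lam + 1)`, then some nonnegative integer combination of the angles is rational. -/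
lemma exists_relation_of_rotations {ℓ lam : ℕ} {α : Fin ℓ → ℝ} {ξ : Fin lam → ℝ}
    {c : Fin ℓ → Fin lam → ℤ} (hα : ∀ i, α i = ∑ j, (c i j : ℝ) * ξ j) {w : ℕ → Fin ℓ} {s : ℝ}
    (hs0 : 0 ≤ s) (hs : s * (lam + 1) < 1)
    (hbox : HasBoxBound (Set.range fun k => Int.fract (-wordSum α w k)) s) :
    ∃ n : Fin ℓ → ℕ, n ≠ 0 ∧ ∃ r : ℚ, ∑ i, (n i : ℝ) * α i = r := by
  obtain ⟨C₀, hC₀, happ⟩ := exists_simultaneous_approximation ξ c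
  obtain ⟨C, hC, hcard⟩ := hbox.card_le
  obtain ⟨δ, hδ, -, hsmall⟩ := exists_small_rpow (e := 1 - s * (lam + 1)) (A := 1 / (12 * C₀ * C))
    (by linarith) (by positivity)
  refine exists_relation_of_bounded_drift (w := w) fun ε hε => ?_
  obtain ⟨N, hN⟩ := exists_nat_gt (max (4 * C₀) (max (C₀ / ε) (1 / δ)))
  have hN1 : 4 * C₀ < N := (le_max_left _ _).trans_lt hN
  have hN2 : C₀ / ε < N := ((le_max_left _ _).trans (le_max_right _ _)).trans_lt hN
  have hN3 : 1 / δ < N := ((le_max_right _ _).trans (le_max_right _ _)).trans_lt hN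
  have hN0 : (0 : ℝ) < N := by linarith
  obtain ⟨q, hq, hqN, P, hP⟩ := happ N (by exact_mod_cast hN0)
  have hq1 : (1 : ℝ) ≤ q := by exact_mod_cast hq
  have hq0 : (0 : ℝ) < q := by linarith
  refine ⟨q, hq, P, fun i => ?_, fun k => ?_⟩
  · rw [hα]
    refine (hP i).trans ?_
    rw [div_le_iff₀ (by positivity)]
    rw [div_lt_iff₀ hε] at hN2
    nlinarith
  · have hηq : C₀ / (q * N) ≤ 1 / (4 * q) := by
      rw [div_le_div_iff₀ (by positivity) (by positivity)]
      nlinarith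
    have h1 := drift_le_of_card_le (α := α) (w := w) hq (η := C₀ / (q * N)) (by positivity) hηq
      (fun i => by rw [hα]; exact hP i) (fun n x hx hsep => by
        have hη1 : C₀ / (q * N) ≤ 1 := by
          refine hηq.trans ?_
          rw [div_le_one (by positivity)]
          linarith
        refine (hcard _ (by positivity) hη1 n x hx hsep).trans_lt ?_
        have e1 : 1 / (12 * q * (C₀ / (q * N))) = N / (12 * C₀) := by field_simp
        rw [e1]
        have e2 : (C₀ / (q * N)) ^ (-s) ≤ (N : ℝ) ^ (s * (lam + 1)) := by
          rw [Real.rpow_neg (by positivity), ← Real.inv_rpow (by positivity), inv_div, mul_comm s,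
            Real.rpow_mul hN0.le]
          refine Real.rpow_le_rpow (by positivity) ?_ hs0
          rw [div_le_iff₀ (by positivity)]
          have e3 : (q : ℝ) ≤ N ^ lam := by exact_mod_cast hqN
          have e4 : (N : ℝ) ^ ((lam : ℝ) + 1) = N ^ lam * N := by
            rw [Real.rpow_add hN0, Real.rpow_one, Real.rpow_natCast]
          rw [e4]
          calc (q : ℝ) * N ≤ N ^ lam * N := by gcongr
            _ ≤ N ^ lam * N * C₀ := le_mul_of_one_le_right (by positivity) hC₀
        have e5 := hsmall (1 / N) (by positivity) (by
          rw [div_le_iff₀ hN0]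
          rw [div_lt_iff₀ hδ] at hN3
          linarith)
        rw [Real.rpow_sub (by positivity), Real.rpow_one, Real.div_rpow zero_le_one hN0.le,
          Real.one_rpow] at e5
        have e6 : (0 : ℝ) < (N : ℝ) ^ (s * (lam + 1)) := by positivity
        rw [div_div_eq_mul_div, div_one, one_div_mul_eq_div,
          div_lt_div_iff₀ hN0 (by positivity), one_mul] at e5
        refine (mul_le_mul_of_nonneg_left e2 hC.le).trans_lt ?_
        rw [lt_div_iff₀ (by positivity)]
        linarith) k
    refine h1.trans ?_
    rw [div_le_one (by positivity)]
    linarith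

/-! ### The contraction ratios of an embedded self-similar set -/

lemma IsContractingSimilitude.dist_eq {d : ℕ} {f : Rd d → Rd d} {r : ℝ}
    (h : IsContractingSimilitude f r) (x y : Rd d) : dist (f x) (f y) = r * dist x y := by
  obtain ⟨h0, -, P, a, hf⟩ := h
  rw [hf, hf, dist_add_right, dist_smul₀, Real.norm_of_nonneg h0.le, P.dist_map]

/-- Renormalized distances along `m ↦ γ ^ m`, of constant size `c`, bound the covering numbers of
the orbit of the prefix ratios on the circle `ℝ / (log γ) ℤ`. -/
lemma hasBoxBound_orbit {ℓ : ℕ} {ρ : Fin ℓ → ℝ} (hρ : ∀ i, 0 < ρ i) (hρ1 : ∀ i, ρ i < 1)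
    {w : ℕ → Fin ℓ} {γ c s : ℝ} (hγ : 0 < γ) (hγ1 : γ < 1) (hc : 0 < c) {S : Set ℝ}
    (hS : HasBoxBound S s)
    (h : ∀ k m : ℕ, γ ^ m ≤ prefixRatio ρ w k → γ ^ m / prefixRatio ρ w k * c ∈ S) :
    HasBoxBound (Set.range fun k =>
      Int.fract (-wordSum (fun i => Real.log (ρ i) / Real.log γ) w k)) s := by
  have hlog : Real.log γ < 0 := Real.log_neg hγ hγ1
  have himg := (hS.mono (B := {x | x ∈ S ∧ γ * c ≤ x}) fun x hx => hx.1).image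
    (fun x => Real.log (x / c) / Real.log γ) (1 / (γ * c * |Real.log γ|)) (by positivity) (by
      have aux : ∀ x, γ * c ≤ x → ∀ y, γ * c ≤ y → Real.log x - Real.log y ≤
          |x - y| / (γ * c) := by
        intro x hx y hy
        have hx0 : 0 < x := lt_of_lt_of_le (by positivity) hx
        have hy0 : 0 < y := lt_of_lt_of_le (by positivity) hy
        rw [← Real.log_div hx0.ne' hy0.ne']
        calc Real.log (x / y) ≤ x / y - 1 := Real.log_le_sub_one_of_pos (by positivity)
          _ = (x - y) / y := by field_simp
          _ ≤ |x - y| / (γ * c) := div_le_div₀ (abs_nonneg _) (le_abs_self _) (by positivity) hy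
      rintro x ⟨-, hx⟩ y ⟨-, hy⟩
      have hx0 : 0 < x := lt_of_lt_of_le (by positivity) hx
      have hy0 : 0 < y := lt_of_lt_of_le (by positivity) hy
      have e : |Real.log x - Real.log y| ≤ |x - y| / (γ * c) := by
        have h1 := aux x hx y hy
        have h2 := aux y hy x hx
        rw [abs_sub_comm] at h2
        rw [abs_le]
        constructor <;> linarith
      rw [Real.dist_eq, Real.dist_eq, Real.log_div hx0.ne' hc.ne', Real.log_div hy0.ne' hc.ne',
        ← sub_div, sub_sub_sub_cancel_right, abs_div]
      calc _ ≤ |x - y| / (γ * c) / |Real.log γ| := by gcongr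
        _ = _ := by field_simp)
  refine himg.mono ?_
  rintro _ ⟨k, rfl⟩
  have hR := prefixRatio_pos hρ w k
  set T := wordSum (fun i => Real.log (ρ i) / Real.log γ) w k with hT
  have hTR : Real.log (prefixRatio ρ w k) = Real.log γ * T := by
    rw [prefixRatio, Real.log_prod fun i _ => (hρ _).ne', hT, wordSum, Finset.mul_sum]
    exact Finset.sum_congr rfl fun i _ => (mul_div_cancel₀ _ hlog.ne).symm
  have hT0 : 0 ≤ T := Finset.sum_nonneg fun i _ =>
    div_nonneg_of_nonpos (Real.log_nonpos (hρ _).le (hρ1 _).le) hlog.le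
  -- the number of steps is the first one after which the contraction is stronger than the cylinder's
  obtain ⟨m, hm⟩ := Int.eq_ofNat_of_zero_le (Int.ceil_nonneg hT0)
  have hfr : Int.fract (-T) = m - T := by
    have : ⌊-T⌋ = -(m : ℤ) := by rw [Int.floor_neg, hm]
    rw [Int.fract, this]
    push_cast
    ring
  have hquot : Real.log (γ ^ m / prefixRatio ρ w k) = Real.log γ * (m - T) := by
    rw [Real.log_div (by positivity) hR.ne', Real.log_pow, hTR]
    ring
  have hfr0 := Int.fract_nonneg (-T)
  have hfr1 := Int.fract_lt_one (-T)
  rw [hfr] at hfr0 hfr1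
  have hmR : γ ^ m ≤ prefixRatio ρ w k := by
    rw [← div_le_one hR, ← Real.log_nonpos_iff (by positivity), hquot]
    exact mul_nonpos_of_nonpos_of_nonneg hlog.le hfr0
  refine ⟨_, ⟨h k m hmR, ?_⟩, ?_⟩
  · gcongr
    rw [← Real.log_le_log_iff hγ (by positivity), hquot]
    nlinarith
  · simp only
    rw [mul_div_cancel_right₀ _ hc.ne', hquot, mul_div_cancel_left₀ _ hlog.ne, hfr]

/-- A nonnegative integer relation between the angles is a multiplicative relation between the
contraction ratios. -/
lemma exists_rational_exponents {ℓ : ℕ} {ρ : Fin ℓ → ℝ} (hρ : ∀ i, 0 < ρ i) (hρ1 : ∀ i, ρ i < 1)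
    {γ : ℝ} (hγ : 0 < γ) (hγ1 : γ < 1) {p : ℕ} (hp : 1 ≤ p) {n : Fin ℓ → ℕ} (hn : n ≠ 0) {r : ℚ}
    (h : ∑ i, (n i : ℝ) * (Real.log (ρ i) / Real.log (γ ^ p)) = r) :
    ∃ t : Fin ℓ → ℚ, (∀ i, 0 ≤ t i) ∧ γ = ∏ i, ρ i ^ (t i : ℝ) := by
  have hlog : Real.log γ < 0 := Real.log_neg hγ hγ1
  have hp0 : (0 : ℝ) < p := by exact_mod_cast hp
  have hlogp : Real.log (γ ^ p) = p * Real.log γ := Real.log_pow _ _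
  have hlogp0 : Real.log (γ ^ p) < 0 := by rw [hlogp]; exact mul_neg_of_pos_of_neg hp0 hlog
  have hpos : ∀ i, 0 < Real.log (ρ i) / Real.log (γ ^ p) := fun i =>
    div_pos_of_neg_of_neg (Real.log_neg (hρ i) (hρ1 i)) hlogp0
  have hr : (0 : ℝ) < r := by
    obtain ⟨i, hi⟩ := Function.ne_iff.1 hn
    rw [← h]
    refine Finset.sum_pos' (fun i _ => mul_nonneg (Nat.cast_nonneg _) (hpos i).le)
      ⟨i, Finset.mem_univ i, mul_pos ?_ (hpos i)⟩
    exact_mod_cast Nat.pos_of_ne_zero hi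
  have hr' : 0 < r := by exact_mod_cast hr
  refine ⟨fun i => n i / (r * p), fun i => by positivity, ?_⟩
  refine Real.log_injOn_pos hγ (Finset.prod_pos fun i _ => Real.rpow_pos_of_pos (hρ i) _) ?_
  rw [Real.log_prod fun i _ => (Real.rpow_pos_of_pos (hρ i) _).ne']
  have e : ∑ i, (n i : ℝ) * Real.log (ρ i) = r * p * Real.log γ := by
    rw [mul_assoc, ← hlogp, ← h, Finset.sum_mul]
    refine Finset.sum_congr rfl fun i _ => ?_
    rw [mul_assoc, div_mul_cancel₀ _ hlogp0.ne]
  have e2 : ∀ i, Real.log (ρ i ^ ((n i / (r * p) : ℚ) : ℝ)) =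
      (1 / (r * p)) * ((n i : ℝ) * Real.log (ρ i)) := fun i => by
    rw [Real.log_rpow (hρ i)]
    push_cast
    ring
  rw [Finset.sum_congr rfl fun i _ => e2 i, ← Finset.mul_sum, e]
  field_simp

lemma one_le_logRank {ℓ : ℕ} (hℓ : 0 < ℓ) {ρ : Fin ℓ → ℝ} (hρ : ∀ i, 0 < ρ i)
    (hρ1 : ∀ i, ρ i < 1) : 1 ≤ logRank ρ := by
  have : FiniteDimensional ℚ (Submodule.span ℚ (Set.range fun i => Real.log (ρ i))) :=
    FiniteDimensional.span_of_finite ℚ (Set.finite_range _)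
  have hx : Real.log (ρ ⟨0, hℓ⟩) ≠ 0 := (Real.log_neg (hρ _) (hρ1 _)).ne
  have : Nontrivial (Submodule.span ℚ (Set.range fun i => Real.log (ρ i))) :=
    ⟨⟨_, Submodule.subset_span ⟨⟨0, hℓ⟩, rfl⟩⟩, 0, fun h => hx (congrArg Subtype.val h)⟩
  exact Module.finrank_pos

/-- Below the threshold, a nonnegative integer relation holds between the rotation angles of any
orbit whose covering exponent is twice the dimension bound. -/
lemma exists_relation_of_lt_threshold {ℓ : ℕ} (hℓ : 0 < ℓ) {ρ : Fin ℓ → ℝ} (hρ : ∀ i, 0 < ρ i)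
    (hρ1 : ∀ i, ρ i < 1) {w : ℕ → Fin ℓ} {g t : ℝ} (ht0 : 0 ≤ t)
    (ht : t < threshold ℓ (logRank ρ))
    (hbox : HasBoxBound (Set.range fun k =>
      Int.fract (-wordSum (fun i => Real.log (ρ i) / g) w k)) (2 * t)) :
    ∃ n : Fin ℓ → ℕ, n ≠ 0 ∧ ∃ r : ℚ, ∑ i, (n i : ℝ) * (Real.log (ρ i) / g) = r := by
  by_cases hℓ2 : ℓ = 2
  · subst hℓ2
    rw [threshold, if_pos rfl] at ht
    exact exists_relation_of_two_rotations (by positivity) (by linarith) hbox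
  · obtain ⟨ξ, c, hξ⟩ := exists_integer_coordinates fun i => Real.log (ρ i)
    have hlam := one_le_logRank hℓ hρ hρ1
    have ht' : t < 1 / (2 * (logRank ρ : ℝ) + 2) := by
      rw [threshold, if_neg hℓ2] at ht
      split_ifs at ht with h1
      · rw [h1]; norm_num; linarith
      · exact ht
    refine exists_relation_of_rotations (ξ := fun j => ξ j / g) (c := c) (fun i => ?_)
      (by positivity) ?_ hbox
    · rw [hξ, Finset.sum_div]
      exact Finset.sum_congr rfl fun j _ => by ring
    · rw [lt_div_iff₀ (by positivity)] at ht'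
      change 2 * t * ((logRank ρ : ℝ) + 1) < 1
      linarith

lemma threshold_le {ℓ lam : ℕ} (hlam : 1 ≤ lam) : threshold ℓ lam ≤ 1 / 4 := by
  rw [threshold]
  split_ifs
  · exact le_rfl
  · exact le_rfl
  · have : (1 : ℝ) ≤ lam := by exact_mod_cast hlam
    exact one_div_le_one_div_of_le (by norm_num) (by linarith)

end AffineEmbedding

open AffineEmbedding in
theorem theorem1p2 {d ℓ m : ℕ}
    (φ : Fin ℓ → AffineEmbedding.Rd d → AffineEmbedding.Rd d) (ρ : Fin ℓ → ℝ)
    (ψ : Fin m → AffineEmbedding.Rd d → AffineEmbedding.Rd d) (γ : Fin m → ℝ)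
    (E F : Set (AffineEmbedding.Rd d))
    (hE : AffineEmbedding.IsSelfSimilarSet φ ρ E)
    (hF : AffineEmbedding.IsSelfSimilarSet ψ γ F)
    (hEdisc : IsTotallyDisconnected E) (hFdisc : IsTotallyDisconnected F)
    (hEnt : E.Nontrivial) (hFnt : F.Nontrivial)
    (hemb : AffineEmbedding.AffinelyEmbeds F E)
    (hSSC : AffineEmbedding.StrongSeparation φ E)
    (hdim : dimH E <
      ENNReal.ofReal (AffineEmbedding.threshold ℓ (AffineEmbedding.logRank ρ))) :
    (∀ j, ∃ t : Fin ℓ → ℚ, (∀ i, 0 ≤ t i) ∧ γ j = ∏ i, ρ i ^ (t i : ℝ)) ∧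
    (∀ r : ℝ, (∀ i, ρ i = r) →
      ∀ j, ∃ q : ℚ, Real.log (γ j) / Real.log r = (q : ℝ)) := by
  obtain ⟨hφs, hEne, hEc, hEφ⟩ := hE
  obtain ⟨hψs, -, hFc, hFψ⟩ := hF
  have hφ : ∀ i x y, dist (φ i x) (φ i y) = ρ i * dist x y := fun i => (hφs i).dist_eq
  have hρ : ∀ i, 0 < ρ i := fun i => (hφs i).1
  have hρ1 : ∀ i, ρ i < 1 := fun i => (hφs i).2.1
  have hℓ : 0 < ℓ := by
    obtain ⟨x, hx⟩ := hEne
    rw [hEφ] at hx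
    obtain ⟨i, -⟩ := Set.mem_iUnion.1 hx
    exact i.pos
  have hcont : ∀ i, Continuous (φ i) := fun i => by
    obtain ⟨-, -, P, a, hf⟩ := hφs i
    rw [funext hf]
    fun_prop
  obtain ⟨D, hD, hgap⟩ := exists_gap hcont hEc hSSC
  obtain ⟨t, hEt, ht⟩ := ENNReal.lt_iff_exists_nnreal_btwn.1 hdim
  have ht' : (t : ℝ) < threshold ℓ (logRank ρ) := by
    rw [ENNReal.ofReal, ENNReal.coe_lt_coe] at ht
    exact Real.lt_toNNReal_iff_coe_lt.1 ht
  have ht4 : (t : ℝ) < 1 / 4 := ht'.trans_le (threshold_le (one_le_logRank hℓ hρ hρ1))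
  have hbox := hasBoxBound_of_dimH_lt hφ hρ hρ1 hEc hEne hEφ.subset hD hgap hEt
  obtain ⟨M, a, hM⟩ := hemb
  have hmain : ∀ j, ∃ t : Fin ℓ → ℚ, (∀ i, 0 ≤ t i) ∧ γ j = ∏ i, ρ i ^ (t i : ℝ) := by
    intro j
    obtain ⟨hγ, hγ1, P, b, hψ⟩ := hψs j
    obtain ⟨w, v, hv, hdist⟩ := exists_renormalized_distances hφ hρ hρ1 hEφ.subset hD hgap hγ hγ1 hψ
      hFc (fun x hx => by rw [hFψ]; exact Set.mem_iUnion.2 ⟨j, x, hx, rfl⟩) hFnt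
      (M := LinearMap.toContinuousLinearMap M.toLinearMap) (a := a)
      (fun x hx => hM ⟨x, hx, rfl⟩)
    set M' : Rd d →L[ℝ] Rd d := LinearMap.toContinuousLinearMap M.toLinearMap with hM'
    have hMinj : Function.Injective M' := M.injective
    obtain ⟨B, hB⟩ := Metric.isBounded_iff.1 hEc.isBounded
    obtain ⟨p, hp, hper⟩ := exists_period hρ hρ1 hγ hγ1 hMinj hv hbox.distSet (by linarith)
      (B := B) (by
        rintro _ ⟨⟨x, y⟩, ⟨hx, hy⟩, rfl⟩
        rw [abs_of_nonneg dist_nonneg]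
        exact hB hx hy) hdist
    -- along the multiples of the period the rotation plays no role
    have hconst : ∀ m, ‖M' (P^[p * m] v)‖ = ‖M' v‖ := fun m => by
      induction m with
      | zero => rfl
      | succ m ih => rw [Nat.mul_succ, hper, ih]
    have hc : 0 < ‖M' v‖ := norm_pos_iff.2 fun h => hv (hMinj (h.trans (map_zero M').symm))
    have horbit := hasBoxBound_orbit hρ hρ1 (w := w) (pow_pos hγ p)
      (pow_lt_one₀ hγ.le hγ1 (by omega)) hc hbox.distSet (fun k m hk => by
        rw [← pow_mul] at hk ⊢
        rw [← hconst m]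
        exact hdist k _ hk)
    obtain ⟨n, hn, r, hr⟩ := exists_relation_of_lt_threshold hℓ hρ hρ1 t.2 ht' horbit
    exact exists_rational_exponents hρ hρ1 hγ hγ1 hp hn hr
  refine ⟨hmain, fun r hr j => ?_⟩
  obtain ⟨t, -, ht⟩ := hmain j
  have hr0 : 0 < r := hr ⟨0, hℓ⟩ ▸ hρ ⟨0, hℓ⟩
  have hr1 : r < 1 := hr ⟨0, hℓ⟩ ▸ hρ1 ⟨0, hℓ⟩
  refine ⟨∑ i, t i, ?_⟩
  rw [div_eq_iff (Real.log_neg hr0 hr1).ne, ht, Real.log_prod fun i _ =>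
    (Real.rpow_pos_of_pos (hρ i) _).ne']
  push_cast
  rw [Finset.sum_mul]
  refine Finset.sum_congr rfl fun i _ => ?_
  rw [Real.log_rpow (hρ i), hr]
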